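/- Let $M$ be a generalised multicategory, and for every tree $T$ of arrows of $M$ let a numbering $\tau_T$ of its nodes be chosen, as used below in the definition of the slice $M_+$. Then \[\xi(M)^+\;\simeq\;\xi(M_+)\] as symmetric multicategories with a category of objects; that is, there is a morphism $F:\xi(M)^+\to\xi(M_+)$ of symmetric multicategories which is an equivalence. This holds for every choice of the numberings $\tau_T$. The notions are as follows. **Symmetric multicategories with a category of objects.** Such a $Q$ consists of a category $\mathbb C=o(Q)$ of objects and object-morphisms; a set $Q(x_1,\dots,x_k;x)$ of arrows for all objects $x_1,\dots,x_k,x$ $(k\ge 0)$; an arrow $\iota(a)\in Q(x;y)$ for every object-morphism $a:x\to y$; composites $f\circ(g_1,\dots,g_k)$, whose source is the concatenation of the sources of the $g_i$; and for each permutation $\sigma\in\mathbf S_k$ a map $Q(x_1,\dots,x_k;x)\to Q(x_{\sigma(1)},\dots,x_{\sigma(k)};x)$, $f\mapsto f\sigma$. Composition is associative with units $1_x=\iota(1_x)$, the symmetric action is an action of the symmetric groups, it is compatible with composition in both variables, and $\iota(b)\circ\iota(a)=\iota(b a)$. A morphism $F:Q\to R$ is a functor $F:o(Q)\to o(R)$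 together with maps $Q(x_1,\dots,x_k;x)\to R(Fx_1,\dots,Fx_k;Fx)$ preserving $\iota$, composition and the symmetric action. It is an *equivalence* if the functor $o(Q)\to o(R)$ is an equivalence of categories and all these maps are bijections; $Q\simeq R$ means that there is an equivalence $Q\to R$. **Generalised multicategories.** Such an $M$ consists of a set $o(M)$ of objects; a set $a(M)$ of arrows $f$, each with a source $s(f)=(x_1,\dots,x_k)$, a finite list of objects with set of positions $|s(f)|=\{1,\dots,k\}$, and a target $t(f)\in o(M)$; identities $1_x:(x)\to x$; and for $t(g)=s(f)_p$ a composite $f\circ_p g$ with $t(f\circ_p g)=t(f)$ and amalgamating maps $\psi[f,g,p]:|s(f)|\setminus\{p\}\to|s(f\circ_p g)|$ and $\phi[f,g,p]:|s(g)|\to|s(f\circ_p g)|$ which preserve the source objects and together form a bijection $(|s(f)|\setminus\{p\})\amalg|s(g)|\cong|s(f\circ_p g)|$. The laws are: - $1_y\circ_1 f=f=f\circ_p 1_x$, where $\phi[1_y,f,1](j)=j$, $\psi[f,1_x,p](i)=i$ and $\phi[f,1_x,p](1)=p$; - $(f\circ_p g)\circ_{\bar q}h=f\circ_p(g\circ_q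 h)$ with $\bar q=\phi[f,g,p](q)$, where on the source positions of $f$, $g$ and $h$ respectively $\psi[f\circ_p g,h,\bar q]\,\psi[f,g,p]=\psi[f,g\circ_q h,p]$, $\ \psi[f\circ_p g,h,\bar q]\,\phi[f,g,p]=\phi[f,g\circ_q h,p]\,\psi[g,h,q]$, $\ \phi[f\circ_p g,h,\bar q]=\phi[f,g\circ_q h,p]\,\phi[g,h,q]$; - for $p\ne q$, $(f\circ_p g)\circ_{\bar q}h=(f\circ_q h)\circ_{\bar p}g$ with $\bar q=\psi[f,g,p](q)$ and $\bar p=\psi[f,h,q](p)$, where $\psi[f\circ_p g,h,\bar q]\,\psi[f,g,p]=\psi[f\circ_q h,g,\bar p]\,\psi[f,h,q]$, $\ \psi[f\circ_p g,h,\bar q]\,\phi[f,g,p]=\phi[f\circ_q h,g,\bar p]$, $\ \phi[f\circ_p g,h,\bar q]=\psi[f\circ_q h,g,\bar p]\,\phi[f,h,q]$. **The symmetric multicategory $\xi(M)$.** Its category of objects is the discrete category on $o(M)$. The elements of $\xi(M)(x_1,\dots,x_k;x)$ are the pairs $(f,\sigma)$ with $\sigma\in\mathbf S_k$ and $f\in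 a(M)$ an arrow $(x_{\sigma(1)},\dots,x_{\sigma(k)})\to x$. Identities are $(1_x,\mathrm{id})$, and the symmetric action is $(f,\tau)\sigma=(f,\sigma^{-1}\tau)$. Composites are formed by composing successively in $M$, for each input of the first arrow, with the arrow of $M$ that belongs to this input; the permutation records how the amalgamating maps reorder the inputs. **The slice $Q^+$ of a symmetric multicategory $Q$.** Its category of objects is $\mathrm{elt}(Q)$: the objects are all arrows of $Q$; a morphism $g\to g'$ consists of a permutation and object-morphisms $b:t(g)\to t(g')$ and, for each $i$, $a_i$ from the source of $g'$ matched with $i$ by the permutation to $s(g)_i$, such that $g'$ is obtained from $\iota(b)\circ g\circ(\iota(a_1),\dots,\iota(a_m))$ by the symmetric action of the permutation. An element of $Q^+(f_1,\dots,f_n;f)$ is a triple $(T,\rho,\tau)$: a planar tree $T$ with $n$ nodes; a bijection $\tau$ from its nodes to $\{1,\dots,n\}$, the node $N$ being labelled by $f_{\tau(N)}$ and having one incoming edge for each input of $f_{\tau(N)}$; a labelling of the edges by object-morphisms of $Q$, the label of the $j$-th incoming edge of a node having as codomain the $j$-th source, and the label of its outgoing edge having as domain the target, of the label of the node; and a permutation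 $\rho$ of the leaves; such that the composite of the labels according to their positions in $T$ (edge labels $a$ acting as $\iota(a)$), permuted by $\rho$, is $f$. Composition is substitution of trees for nodes, composing the labels of the edges that are joined and moving all permutations to the leaves; $\iota(\alpha)$ for $\alpha:g\to g'$ is the tree with one node labelled $g$ and edges labelled by the components of $\alpha$; and $(T,\rho,\tau)\sigma=(T,\rho,\sigma^{-1}\tau)$. **The slice $M_+$ of a generalised multicategory $M$.** Its objects are the arrows of $M$. Its arrows are the planar trees $T$ whose nodes are labelled by arrows of $M$ and whose edges are labelled by objects of $M$, the incoming edges of a node labelled $f$ being labelled by $s(f)$ from left to right and its outgoing edge by $t(f)$. For each $T$ with $n$ nodes one bijection $\tau_T$ from its nodes to $\{1,\dots,n\}$ is chosen. Then $s(T)=(f_1,\dots,f_n)$, where $f_i$ is the label of the node $\tau_T^{-1}(i)$, and $t(T)$ is the composite in $M$ of the labels according to their positions in $T$; the inputs of $t(T)$ are matched with the leaves of $T$ through the amalgamating maps of $M$. The composite $T_1\circ_m T_2$ replaces the node $\tau_{T_1}^{-1}(m)$ of $T_1$ by $T_2$, its amalgamating maps follow the nodes of $T_1$ and $T_2$ through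 this replacement with respect to $\tau_{T_1}$, $\tau_{T_2}$ and $\tau_T$, and $1_f$ is the tree with one node, labelled $f$. -/

import Mathlib

open CategoryTheory

universe u v w u' v' w'

/-! ### Positions in concatenated lists -/

namespace Pos

/-- The position `p` in a concatenation of `k` lists of lengths `m 0, …, m (k-1)`, written as
(number of the list, position in that list), in the usual left to right order. -/
def split {k : ℕ} {m : Fin k → ℕ} : Fin (∑ i, m i) ≃ (Σ i : Fin k, Fin (m i)) :=
  finSigmaFinEquiv.symm

/-- A single list of length `n`, concatenated. -/
def unitL (n : ℕ) : Fin (∑ _ : Fin 1, n) ≃ Fin n where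
  toFun p := (split p).2
  invFun i := split.symm ⟨0, i⟩
  left_inv p := by
    rw [Equiv.symm_apply_eq]
    exact Sigma.ext (Subsingleton.elim _ _) HEq.rfl
  right_inv i := by simp

/-- `n` lists of length one, concatenated. -/
def unitR (n : ℕ) : Fin (∑ _ : Fin n, 1) ≃ Fin n where
  toFun p := (split p).1
  invFun i := split.symm ⟨i, 0⟩
  left_inv p := by
    rw [Equiv.symm_apply_eq]
    exact Sigma.ext rfl (heq_of_eq (Subsingleton.elim _ _))
  right_inv i := by simp

/-- The two ways of concatenating lists of lists of lists. -/
def assoc {k : ℕ} (m : Fin k → ℕ) (r : ∀ i, Fin (m i) → ℕ) :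
    Fin (∑ q : Fin (∑ i, m i), r (split q).1 (split q).2) ≃ Fin (∑ i, ∑ j, r i j) :=
  split.trans <|
    (Equiv.sigmaCongrLeft (β := fun a : (Σ i, Fin (m i)) => Fin (r a.1 a.2)) split).trans <|
    (Equiv.sigmaAssoc (fun i (j : Fin (m i)) => Fin (r i j))).trans <|
    (Equiv.sigmaCongrRight fun _ => split.symm).trans split.symm

/-- The block permutation induced by a permutation `σ` of the blocks. -/
def block {k k' : ℕ} (σ : Fin k' ≃ Fin k) (m : Fin k → ℕ) :
    Fin (∑ i, m (σ i)) ≃ Fin (∑ i, m i) :=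
  split.trans <| (Equiv.sigmaCongrLeft (β := fun i => Fin (m i)) σ).trans split.symm

/-- The juxtaposition of permutations `σ i`. -/
def juxt {k : ℕ} {m m' : Fin k → ℕ} (σ : ∀ i, Fin (m' i) ≃ Fin (m i)) :
    Fin (∑ i, m' i) ≃ Fin (∑ i, m i) :=
  split.trans <| (Equiv.sigmaCongrRight σ).trans split.symm

theorem unitL_apply {n : ℕ} (p : Fin (∑ _ : Fin 1, n)) : unitL n p = (split p).2 := rfl

theorem unitR_apply {n : ℕ} (p : Fin (∑ _ : Fin n, 1)) : unitR n p = (split p).1 := rfl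

theorem split_assoc {k : ℕ} (m : Fin k → ℕ) (r : ∀ i, Fin (m i) → ℕ)
    (p : Fin (∑ q : Fin (∑ i, m i), r (split q).1 (split q).2)) :
    split (assoc m r p) = ⟨(split (split p).1).1,
      split.symm ⟨(split (split p).1).2, (split p).2⟩⟩ := by
  simp [assoc, Equiv.sigmaCongrLeft, Equiv.sigmaAssoc]

theorem split_block {k k' : ℕ} (σ : Fin k' ≃ Fin k) (m : Fin k → ℕ) (p : Fin (∑ i, m (σ i))) :
    split (block σ m p) = ⟨σ (split p).1, (split p).2⟩ := by
  simp [block, Equiv.sigmaCongrLeft]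

theorem split_juxt {k : ℕ} {m m' : Fin k → ℕ} (σ : ∀ i, Fin (m' i) ≃ Fin (m i))
    (p : Fin (∑ i, m' i)) :
    split (juxt σ p) = ⟨(split p).1, σ _ (split p).2⟩ := by
  simp [juxt]

theorem src_split {C : Sort*} {k : ℕ} {m : Fin k → ℕ} (z : ∀ i, Fin (m i) → C) (i : Fin k)
    (j : Fin (m i)) : (fun p : Fin (∑ i, m i) => z (split p).1 (split p).2) (split.symm ⟨i, j⟩) =
      z i j := by
  change z (split (split.symm ⟨i, j⟩)).1 (split (split.symm ⟨i, j⟩)).2 = z i j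
  rw [Equiv.apply_symm_apply]

theorem src_assoc {C : Sort*} {k : ℕ} (m : Fin k → ℕ) (r : ∀ i, Fin (m i) → ℕ)
    (w : ∀ i j, Fin (r i j) → C) (p : Fin (∑ q : Fin (∑ i, m i), r (split q).1 (split q).2)) :
    w (split (split p).1).1 (split (split p).1).2 (split p).2 =
      w (split (assoc m r p)).1 (split (split (assoc m r p)).2).1
        (split (split (assoc m r p)).2).2 := by
  rw [split_assoc]
  simp only []
  rw [Equiv.apply_symm_apply]

theorem src_block {C : Sort*} {k k' : ℕ} (σ : Fin k' ≃ Fin k) (m : Fin k → ℕ)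
    (z : ∀ i, Fin (m i) → C) (p : Fin (∑ i, m (σ i))) :
    z (σ (split p).1) (split p).2 = z (split (block σ m p)).1 (split (block σ m p)).2 := by
  rw [split_block]

theorem src_juxt {C : Sort*} {k : ℕ} {m m' : Fin k → ℕ} (σ : ∀ i, Fin (m' i) ≃ Fin (m i))
    (z : ∀ i, Fin (m i) → C) (z' : ∀ i, Fin (m' i) → C) (h : ∀ i j, z' i j = z i (σ i j))
    (p : Fin (∑ i, m' i)) :
    z' (split p).1 (split p).2 = z (split (juxt σ p)).1 (split (juxt σ p)).2 := by
  rw [split_juxt, h]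

end Pos

open Pos

/-! ### Symmetric multicategories -/

/-- A symmetric multicategory with a category of objects.

A bijection `σ : Fin n ≃ Fin m` forces `n = m`, so `act` is the action of the symmetric groups:
for `f ∈ Q(x_1, …, x_k; y)` it gives `f σ ∈ Q(x_{σ(1)}, …, x_{σ(k)}; y)`.  The source of `f σ` is
allowed to be any list equal to `(x_{σ(1)}, …, x_{σ(k)})`. -/
structure SymMulticat where
  /-- objects -/
  Obj : Type u
  /-- object-morphisms -/
  [cat : Category.{v} Obj]
  /-- the set `Q(x_1, …, x_n; y)` of arrows -/
  Arr : ∀ {n : ℕ}, (Fin n → Obj) → Obj → Type w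
  /-- the arrow given by an object-morphism -/
  ι : ∀ {x y : Obj}, (x ⟶ y) → Arr (fun _ : Fin 1 => x) y
  /-- composition `f ∘ (g_1, …, g_k)` -/
  comp : ∀ {k : ℕ} {x : Fin k → Obj} {y : Obj} {m : Fin k → ℕ} {z : ∀ i, Fin (m i) → Obj},
    Arr x y → (∀ i, Arr (z i) (x i)) →
      Arr (fun p : Fin (∑ i, m i) => z (split p).1 (split p).2) y
  /-- symmetric action -/
  act : ∀ {n m : ℕ} {x : Fin m → Obj} {x' : Fin n → Obj} {y : Obj} (σ : Fin n ≃ Fin m),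
    (∀ i, x' i = x (σ i)) → Arr x y → Arr x' y
  one_comp : ∀ {n : ℕ} {x : Fin n → Obj} {y : Obj} (f : Arr x y),
    comp (ι (𝟙 y)) (fun _ : Fin 1 => f) = act (unitL n) (fun _ => rfl) f
  comp_one : ∀ {n : ℕ} {x : Fin n → Obj} {y : Obj} (f : Arr x y),
    comp f (fun i => ι (𝟙 (x i))) = act (unitR n) (fun _ => rfl) f
  comp_assoc : ∀ {k : ℕ} {x : Fin k → Obj} {y : Obj} {m : Fin k → ℕ}
    {z : ∀ i, Fin (m i) → Obj} {r : ∀ i, Fin (m i) → ℕ} {t : ∀ i j, Fin (r i j) → Obj}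
    (f : Arr x y) (g : ∀ i, Arr (z i) (x i)) (h : ∀ i j, Arr (t i j) (z i j)),
    comp (comp f g) (fun q => h (split q).1 (split q).2) =
      act (Pos.assoc m r) (src_assoc m r t) (comp f fun i => comp (g i) (h i))
  act_refl : ∀ {n : ℕ} {x : Fin n → Obj} {y : Obj} (f : Arr x y),
    act (Equiv.refl (Fin n)) (fun _ => rfl) f = f
  act_act : ∀ {n m l : ℕ} {x : Fin l → Obj} {x' : Fin m → Obj} {x'' : Fin n → Obj} {y : Obj}
    (σ : Fin m ≃ Fin l) (σ' : Fin n ≃ Fin m) (h : ∀ i, x' i = x (σ i))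
    (h' : ∀ i, x'' i = x' (σ' i)) (f : Arr x y),
    act σ' h' (act σ h f) = act (σ'.trans σ) (fun i => (h' i).trans (h (σ' i))) f
  act_comp : ∀ {k k' : ℕ} {x : Fin k → Obj} {y : Obj} {m : Fin k → ℕ}
    {z : ∀ i, Fin (m i) → Obj} (σ : Fin k' ≃ Fin k) (f : Arr x y) (g : ∀ i, Arr (z i) (x i)),
    comp (act (x' := fun i => x (σ i)) σ (fun _ => rfl) f) (fun i => g (σ i)) =
      act (block σ m) (src_block σ m z) (comp f g)
  comp_act : ∀ {k : ℕ} {x : Fin k → Obj} {y : Obj} {m m' : Fin k → ℕ}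
    {z : ∀ i, Fin (m i) → Obj} {z' : ∀ i, Fin (m' i) → Obj} (f : Arr x y)
    (g : ∀ i, Arr (z i) (x i)) (σ : ∀ i, Fin (m' i) ≃ Fin (m i))
    (h : ∀ i j, z' i j = z i (σ i j)),
    comp f (fun i => act (σ i) (h i) (g i)) = act (juxt σ) (src_juxt σ z z' h) (comp f g)
  ι_comp : ∀ {x y z : Obj} (a : x ⟶ y) (b : y ⟶ z),
    comp (ι b) (fun _ : Fin 1 => ι a) = act (unitL 1) (fun _ => rfl) (ι (a ≫ b))

attribute [instance] SymMulticat.cat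

namespace SymMulticat

/-- A morphism of symmetric multicategories. -/
structure Hom (Q : SymMulticat.{u, v, w}) (R : SymMulticat.{u', v', w'}) where
  /-- the functor on object-categories -/
  F₀ : Q.Obj ⥤ R.Obj
  /-- the action on arrows -/
  map : ∀ {n : ℕ} {x : Fin n → Q.Obj} {y : Q.Obj},
    Q.Arr x y → R.Arr (fun i => F₀.obj (x i)) (F₀.obj y)
  map_ι : ∀ {x y : Q.Obj} (a : x ⟶ y), map (Q.ι a) = R.ι (F₀.map a)
  map_comp : ∀ {k : ℕ} {x : Fin k → Q.Obj} {y : Q.Obj} {m : Fin k → ℕ}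
    {z : ∀ i, Fin (m i) → Q.Obj} (f : Q.Arr x y) (g : ∀ i, Q.Arr (z i) (x i)),
    map (Q.comp f g) = R.comp (map f) (fun i => map (g i))
  map_act : ∀ {n m : ℕ} {x : Fin m → Q.Obj} {x' : Fin n → Q.Obj} {y : Q.Obj}
    (σ : Fin n ≃ Fin m) (h : ∀ i, x' i = x (σ i)) (f : Q.Arr x y),
    map (Q.act σ h f) = R.act σ (fun i => congrArg F₀.obj (h i)) (map f)

/-- A morphism is an equivalence if it is an equivalence on object-categories and is full and
faithful. -/
def Hom.IsEquivalence {Q : SymMulticat.{u, v, w}} {R : SymMulticat.{u', v', w'}}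
    (F : Hom Q R) : Prop :=
  F.F₀.IsEquivalence ∧
    ∀ {n : ℕ} (x : Fin n → Q.Obj) (y : Q.Obj),
      Function.Bijective (F.map : Q.Arr x y → R.Arr (fun i => F.F₀.obj (x i)) (F.F₀.obj y))

/-- `Q ≃ R`: there is an equivalence from `Q` to `R`. -/
def Equivalent (Q : SymMulticat.{u, v, w}) (R : SymMulticat.{u', v', w'}) : Prop :=
  ∃ F : Hom Q R, F.IsEquivalence

variable (Q : SymMulticat.{u, v, w})

theorem act_id {n : ℕ} {x : Fin n → Q.Obj} {y : Q.Obj} (σ : Fin n ≃ Fin n)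
    (hσ : ∀ i, σ i = i) (h : ∀ i, x i = x (σ i)) (f : Q.Arr x y) : Q.act σ h f = f := by
  obtain rfl : σ = Equiv.refl _ := Equiv.ext hσ
  exact Q.act_refl f

/-! ### Arrows with labelled inputs -/

/-- An arrow `f` of `Q` with target `d` together with a labelling of its inputs by elements of
`L`, an input labelled by `l` being of type `x l`. -/
structure LArr {L : Type} (x : L → Q.Obj) (d : Q.Obj) where
  n : ℕ
  lab : Fin n → L
  arr : Q.Arr (fun i => x (lab i)) d

variable {Q}

namespace LArr

variable {K L : Type} {x : L → Q.Obj} {d : Q.Obj}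

/-- Two labelled arrows agree up to the symmetric action: `b = a σ` for a permutation `σ`
respecting the labels. -/
def Rel (a b : LArr Q x d) : Prop :=
  ∃ (σ : Fin b.n ≃ Fin a.n) (h : ∀ i, b.lab i = a.lab (σ i)),
    b.arr = Q.act σ (fun i => congrArg x (h i)) a.arr

/-- An arrow of `Q`, its inputs being labelled by their positions. -/
def of {n : ℕ} {x : Fin n → Q.Obj} {d : Q.Obj} (f : Q.Arr x d) : LArr Q x d :=
  ⟨n, fun i => i, f⟩

/-- An object-morphism as a labelled arrow with one input. -/
def edge {c : Q.Obj} (l : L) (a : x l ⟶ c) : LArr Q x c := ⟨1, fun _ => l, Q.ι a⟩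

/-- The composite `f ∘ (e_1, …, e_k)` of an arrow `f` with labelled arrows `e_i`. -/
def comp {k : ℕ} {y : Fin k → Q.Obj} (f : Q.Arr y d) (e : ∀ j, LArr Q x (y j)) : LArr Q x d :=
  ⟨∑ j, (e j).n, fun p => (e (split p).1).lab (split p).2, Q.comp f fun j => (e j).arr⟩

theorem Rel.refl (a : LArr Q x d) : Rel a a :=
  ⟨Equiv.refl _, fun _ => rfl, (Q.act_refl _).symm⟩

theorem Rel.of_eq {a b : LArr Q x d} (h : a = b) : Rel a b := h ▸ Rel.refl a

theorem Rel.symm {a b : LArr Q x d} (hab : Rel a b) : Rel b a := by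
  obtain ⟨n, lab, arr⟩ := a
  obtain ⟨n', lab', arr'⟩ := b
  obtain ⟨σ, h, e⟩ := hab
  dsimp only at σ h e
  have hn : n' = n := by simpa using Fintype.card_congr σ
  subst hn
  obtain rfl : lab' = fun i => lab (σ i) := funext h
  refine ⟨σ.symm, fun i => by simp, ?_⟩
  dsimp only
  rw [e, Q.act_act]
  exact (Q.act_id _ (fun i => by simp) _ _).symm

theorem Rel.trans {a b c : LArr Q x d} (hab : Rel a b) (hbc : Rel b c) : Rel a c := by
  obtain ⟨σ, h, e⟩ := hab
  obtain ⟨τ, h', e'⟩ := hbc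
  refine ⟨τ.trans σ, fun i => by simp [h, h'], ?_⟩
  rw [e', e, Q.act_act]

theorem comp_congr {k : ℕ} {y : Fin k → Q.Obj} (f : Q.Arr y d) {e e' : ∀ j, LArr Q x (y j)}
    (h : ∀ j, Rel (e j) (e' j)) : Rel (comp f e) (comp f e') := by
  choose σ hl ha using h
  refine ⟨juxt σ, fun i => ?_, ?_⟩
  · exact src_juxt σ (fun j => (e j).lab) (fun j => (e' j).lab) hl i
  · change Q.comp f (fun j => (e' j).arr) = _
    simp only [ha]
    exact Q.comp_act f (fun j => (e j).arr) σ (fun i j => congrArg x (hl i j))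

/-- Substitution of labelled arrows for the labels of a labelled arrow. -/
def bind {y : K → Q.Obj} (a : LArr Q y d) (s : ∀ k, LArr Q x (y k)) : LArr Q x d :=
  comp a.arr (fun i => s (a.lab i))

theorem bind_congr_left {y : K → Q.Obj} {a b : LArr Q y d} (h : Rel a b)
    (s : ∀ k, LArr Q x (y k)) : Rel (bind a s) (bind b s) := by
  obtain ⟨n', lab', arr'⟩ := b
  obtain ⟨σ, h, e⟩ := h
  dsimp only at σ h e
  obtain rfl : lab' = fun i => a.lab (σ i) := funext h
  obtain rfl : arr' = Q.act (x' := fun i => y (a.lab (σ i))) σ (fun _ => rfl) a.arr := e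
  refine ⟨block σ (fun i => (s (a.lab i)).n), fun i => ?_, ?_⟩
  · exact src_block σ _ (fun i => (s (a.lab i)).lab) i
  · exact Q.act_comp σ a.arr (fun i => (s (a.lab i)).arr)

theorem bind_congr {y : K → Q.Obj} {a b : LArr Q y d} (h : Rel a b)
    {s t : ∀ k, LArr Q x (y k)} (h' : ∀ k, Rel (s k) (t k)) : Rel (bind a s) (bind b t) :=
  (bind_congr_left h s).trans (comp_congr _ fun _ => h' _)

theorem bind_comp {k : ℕ} {y : Fin k → Q.Obj} {z : K → Q.Obj} (f : Q.Arr y d)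
    (e : ∀ j, LArr Q z (y j)) (s : ∀ i, LArr Q x (z i)) :
    Rel (comp f fun j => bind (e j) s) (bind (comp f e) s) := by
  refine ⟨Pos.assoc (fun j => (e j).n) (fun j i => (s ((e j).lab i)).n), fun p => ?_, ?_⟩
  · exact src_assoc _ _ (fun j i => (s ((e j).lab i)).lab) p
  · exact Q.comp_assoc f (fun j => (e j).arr) (fun j i => (s ((e j).lab i)).arr)

theorem one_comp (a : LArr Q x d) : Rel a (comp (Q.ι (𝟙 d)) fun _ : Fin 1 => a) :=
  ⟨unitL a.n, fun _ => rfl, Q.one_comp a.arr⟩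

theorem bind_of {n : ℕ} {y : Fin n → Q.Obj} (f : Q.Arr y d) (s : ∀ k, LArr Q x (y k)) :
    bind (of f) s = comp f s := rfl

theorem comp_one {n : ℕ} {y : Fin n → Q.Obj} (f : Q.Arr y d) :
    Rel (of f) (comp f fun i => edge i (𝟙 (y i))) :=
  ⟨unitR n, fun _ => rfl, Q.comp_one f⟩

theorem edge_comp {c c' : Q.Obj} (l : L) (a : x l ⟶ c) (b : c ⟶ c') :
    Rel (edge l (a ≫ b)) (comp (Q.ι b) fun _ : Fin 1 => edge l a) :=
  ⟨unitL 1, fun _ => rfl, Q.ι_comp a b⟩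

theorem comp_comp {k : ℕ} {y : Fin k → Q.Obj} {m : Fin k → ℕ} {z : ∀ i, Fin (m i) → Q.Obj}
    (f : Q.Arr y d) (g : ∀ i, Q.Arr (z i) (y i)) (e : ∀ i j, LArr Q x (z i j)) :
    Rel (comp f fun i => comp (g i) (e i))
      (comp (Q.comp f g) fun q => e (split q).1 (split q).2) :=
  ⟨Pos.assoc m (fun i j => (e i j).n), fun p => src_assoc _ _ (fun i j => (e i j).lab) p,
    Q.comp_assoc f g (fun i j => (e i j).arr)⟩

/-- `ι(a ≫ b) ∘ e = ι(b) ∘ (ι(a) ∘ e)`. -/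
theorem ι_comp {c c' : Q.Obj} (a : d ⟶ c) (b : c ⟶ c') (e : LArr Q x d) :
    Rel (comp (Q.ι (a ≫ b)) fun _ : Fin 1 => e)
      (comp (Q.ι b) fun _ : Fin 1 => comp (Q.ι a) fun _ : Fin 1 => e) := by
  have h := bind_congr_left (edge_comp (x := fun _ : Fin 1 => d) 0 a b) (fun _ => e)
  refine h.trans (bind_comp (Q.ι b) _ _).symm

theorem Rel.of_arr {n : ℕ} {y : Fin n → Q.Obj} {f g : Q.Arr y d} (h : Rel (of f) (of g)) :
    f = g := by
  obtain ⟨σ, h, e⟩ := h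
  obtain rfl : σ = Equiv.refl _ := Equiv.ext fun i => (h i).symm
  exact ((Q.act_refl f).symm.trans e.symm)

end LArr

end SymMulticat

namespace SymMulticat

/-! ### Trees of arrows -/

/-- The set `a(Q)` of all arrows of `Q`, each with its source and target. -/
structure Elt (Q : SymMulticat.{u, v, w}) where
  n : ℕ
  src : Fin n → Q.Obj
  tgt : Q.Obj
  arr : Q.Arr src tgt

/-- Planar trees whose nodes are labelled by arrows of `Q` and whose edges are labelled by
object-morphisms of `Q`.

Every node carries a number `i : I`, and the node numbered `i` is labelled by the arrow `F i`.
Every leaf carries a number `l : L`, and the label of the leaf edge numbered `l` has domain `x l`.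
The index `d` is the codomain of the label of the root edge.  The edge below a node labelled `g`
has a label with domain the target of `g`, and the edges above it have labels with codomains the
sources of `g`, from left to right. -/
inductive Tree (Q : SymMulticat.{u, v, w}) {I : Type} (F : I → Elt Q) {L : Type}
    (x : L → Q.Obj) : Q.Obj → Type (max u v w)
  /-- the tree without nodes, consisting of one edge labelled `a` -/
  | leaf {d : Q.Obj} (l : L) (a : x l ⟶ d) : Tree Q F x d
  /-- the tree with root edge labelled `b`, root node labelled `g` with number `i`, and subtrees
  `ch j` above the root node -/
  | node {d : Q.Obj} (i : I) (g : Elt Q) (h : F i = g) (b : g.tgt ⟶ d)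
      (ch : ∀ j : Fin g.n, Tree Q F x (g.src j)) : Tree Q F x d

variable {Q : SymMulticat.{u, v, w}}

namespace Tree

variable {I J H : Type} {F : I → Elt Q} {G : J → Elt Q} {E : H → Elt Q}
  {K L N : Type} {x : L → Q.Obj} {y : K → Q.Obj} {z : N → Q.Obj} {d : Q.Obj}

/-- The numbers of the nodes, with multiplicity. -/
def nodes {d : Q.Obj} : Tree Q F x d → Multiset I
  | leaf _ _ => 0
  | node i _ _ _ ch => i ::ₘ ∑ j, (ch j).nodes

/-- The numbers of the leaves, with multiplicity. -/
def leaves {d : Q.Obj} : Tree Q F x d → Multiset L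
  | leaf l _ => {l}
  | node _ _ _ _ ch => ∑ j, (ch j).leaves

/-- The arrow obtained by composing the labels of a tree according to their positions, the edge
labels acting as arrows `ι(a)`; its inputs, in the planar order of the leaves, are labelled by the
numbers of the leaves. -/
def eval {d : Q.Obj} : Tree Q F x d → LArr Q x d
  | leaf l a => LArr.edge l a
  | node _ g _ b ch => LArr.comp (Q.ι b) fun _ : Fin 1 => LArr.comp g.arr fun j => (ch j).eval

/-- Compose the label of the root edge with `b`. -/
def post {d d' : Q.Obj} (b : d ⟶ d') : Tree Q F x d → Tree Q F x d'
  | leaf l a => leaf l (a ≫ b)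
  | node i g h c ch => node i g h (c ≫ b) ch

/-- Replace each leaf with number `k` by the tree `s k`, composing the labels of the edges which
are joined. -/
def graft {d : Q.Obj} (s : ∀ k, Tree Q F x (y k)) : Tree Q F y d → Tree Q F x d
  | leaf k a => (s k).post a
  | node i g h b ch => node i g h b fun j => (ch j).graft s

/-- Renumber the nodes. -/
def relabel {d : Q.Obj} (φ : I → J) (hφ : ∀ i, G (φ i) = F i) : Tree Q F x d → Tree Q G x d
  | leaf l a => leaf l a
  | node i g h b ch => node (φ i) g ((hφ i).trans h) b fun j => (ch j).relabel φ hφ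

/-- Replace each node with number `i` by the tree `S i`; the subtree above the `j`-th input of the
node is attached at the leaf of `S i` with number `j`. -/
def subst {d : Q.Obj} (S : ∀ i, Tree Q G (F i).src (F i).tgt) : Tree Q F x d → Tree Q G x d
  | leaf l a => leaf l a
  | node i g h b ch =>
    post b (graft (fun j => (ch j).subst S) (h ▸ S i : Tree Q G g.src g.tgt))

/-- The tree with one node labelled `g`, root edge labelled by an identity, and leaf edges labelled
by identities. -/
def corolla (i : I) (g : Elt Q) (h : F i = g) : Tree Q F g.src g.tgt :=
  node i g h (𝟙 _) fun j => leaf j (𝟙 _)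

@[simp] theorem post_leaf {d' : Q.Obj} (b : d ⟶ d') (l : L) (a : x l ⟶ d) :
    (leaf l a : Tree Q F x d).post b = leaf l (a ≫ b) := rfl

@[simp] theorem post_node {d' : Q.Obj} (b : d ⟶ d') (i : I) (g : Elt Q) (h : F i = g)
    (c : g.tgt ⟶ d) (ch : ∀ j, Tree Q F x (g.src j)) :
    (node i g h c ch).post b = node i g h (c ≫ b) ch := rfl

@[simp] theorem post_id (T : Tree Q F x d) : T.post (𝟙 d) = T := by
  cases T <;> simp

@[simp] theorem post_post {d' d'' : Q.Obj} (b : d ⟶ d') (c : d' ⟶ d'') (T : Tree Q F x d) :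
    (T.post b).post c = T.post (b ≫ c) := by
  cases T <;> simp

@[simp] theorem graft_post {d' : Q.Obj} (b : d ⟶ d') (s : ∀ k, Tree Q F x (y k))
    (T : Tree Q F y d) : (T.post b).graft s = (T.graft s).post b := by
  cases T <;> simp [graft]

@[simp] theorem graft_graft (t : ∀ k, Tree Q F x (z k)) (s : ∀ k, Tree Q F z (y k))
    (T : Tree Q F y d) : (T.graft s).graft t = T.graft fun k => (s k).graft t := by
  induction T with
  | leaf k a => simp [graft]
  | node i g h b ch ih => simp [graft, ih]

@[simp] theorem graft_leaf (T : Tree Q F x d) : (T.graft fun k => leaf k (𝟙 _)) = T := by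
  induction T with
  | leaf k a => simp [graft]
  | node i g h b ch ih => simp [graft, ih]

@[simp] theorem relabel_post (φ : I → J) (hφ : ∀ i, G (φ i) = F i) {d' : Q.Obj} (b : d ⟶ d')
    (T : Tree Q F x d) : (T.post b).relabel φ hφ = (T.relabel φ hφ).post b := by
  cases T <;> simp [relabel]

@[simp] theorem relabel_graft (φ : I → J) (hφ : ∀ i, G (φ i) = F i)
    (s : ∀ k, Tree Q F x (y k)) (T : Tree Q F y d) :
    (T.graft s).relabel φ hφ = (T.relabel φ hφ).graft fun k => (s k).relabel φ hφ := by
  induction T with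
  | leaf k a => simp [graft, relabel]
  | node i g h b ch ih => simp [graft, relabel, ih]

@[simp] theorem relabel_relabel (φ : I → J) (hφ : ∀ i, G (φ i) = F i) (ψ : J → H)
    (hψ : ∀ i, E (ψ i) = G i) (T : Tree Q F x d) :
    (T.relabel φ hφ).relabel ψ hψ = T.relabel (fun i => ψ (φ i))
      (fun i => (hψ _).trans (hφ i)) := by
  induction T with
  | leaf k a => simp [relabel]
  | node i g h b ch ih => simp [relabel, ih]

theorem cast_apply {A : Type} (X : A → Elt Q) (P : ∀ a, Tree Q G (X a).src (X a).tgt)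
    {g : Elt Q} {a b : A} (hab : a = b) (e : X a = g) (e' : X b = g) :
    (e ▸ P a : Tree Q G g.src g.tgt) = e' ▸ P b := by
  subst hab
  rfl

theorem relabel_congr {φ ψ : I → J} (h : ∀ i, φ i = ψ i) (hφ : ∀ i, G (φ i) = F i)
    (hψ : ∀ i, G (ψ i) = F i) (T : Tree Q F x d) : T.relabel φ hφ = T.relabel ψ hψ := by
  obtain rfl : φ = ψ := funext h
  rfl

theorem relabel_id (φ : I → I) (hφ : ∀ i, F (φ i) = F i) (h : ∀ i, φ i = i)
    (T : Tree Q F x d) : T.relabel φ hφ = T := by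
  obtain rfl : φ = id := funext h
  induction T with
  | leaf k a => simp [relabel]
  | node i g h b ch ih => simp [relabel, ih]

@[simp] theorem subst_post (S : ∀ i, Tree Q G (F i).src (F i).tgt) {d' : Q.Obj} (b : d ⟶ d')
    (T : Tree Q F x d) : (T.post b).subst S = (T.subst S).post b := by
  cases T <;> simp [subst]

@[simp] theorem subst_graft (S : ∀ i, Tree Q G (F i).src (F i).tgt)
    (s : ∀ k, Tree Q F x (y k)) (T : Tree Q F y d) :
    (T.graft s).subst S = (T.subst S).graft fun k => (s k).subst S := by
  induction T with
  | leaf k a => simp [graft, subst]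
  | node i g h b ch ih => simp [graft, subst, ih]

theorem subst_subst (R : ∀ i, Tree Q E (G i).src (G i).tgt)
    (S : ∀ i, Tree Q G (F i).src (F i).tgt) (T : Tree Q F x d) :
    (T.subst S).subst R = T.subst fun i => (S i).subst R := by
  induction T with
  | leaf k a => simp [subst]
  | node i g h b ch ih => subst h; simp [subst, ih]

theorem relabel_subst (φ : J → H) (hφ : ∀ i, E (φ i) = G i)
    (S : ∀ i, Tree Q G (F i).src (F i).tgt) (T : Tree Q F x d) :
    (T.subst S).relabel φ hφ = T.subst fun i => (S i).relabel φ hφ := by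
  induction T with
  | leaf k a => simp [subst, relabel]
  | node i g h b ch ih => subst h; simp [subst, ih]

theorem subst_relabel (φ : I → J) (hφ : ∀ i, G (φ i) = F i)
    (S : ∀ i, Tree Q E (G i).src (G i).tgt) (S' : ∀ i, Tree Q E (F i).src (F i).tgt)
    (hS : ∀ i, (hφ i ▸ S (φ i) : Tree Q E (F i).src (F i).tgt) = S' i) (T : Tree Q F x d) :
    (T.relabel φ hφ).subst S = T.subst S' := by
  induction T with
  | leaf k a => simp [subst, relabel]
  | node i g h b ch ih =>
    subst h
    simp only [relabel, subst, ih, ← hS i]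

theorem subst_corolla (S : ∀ i, Tree Q G (F i).src (F i).tgt) (i : I) :
    (corolla i (F i) rfl).subst S = S i := by
  simp [corolla, subst]

theorem relabel_corolla (φ : I → J) (hφ : ∀ i, G (φ i) = F i) (i : I) :
    (corolla i (F i) rfl).relabel φ hφ = corolla (φ i) (F i) (hφ i) := by
  simp [corolla, relabel]

/-- Replacing each node by a corolla only renumbers the nodes. -/
theorem subst_eq_relabel (φ : I → J) (hφ : ∀ i, G (φ i) = F i) (T : Tree Q F x d) :
    (T.subst fun i => corolla (φ i) (F i) (hφ i)) = T.relabel φ hφ := by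
  induction T with
  | leaf k a => simp [subst, relabel]
  | node i g h b ch ih => 
    subst h
    simp only [corolla] at ih ⊢
    simp [subst, ih, graft, relabel]

/-! Counting nodes and leaves. -/

@[simp] theorem nodes_post {d' : Q.Obj} (b : d ⟶ d') (T : Tree Q F x d) :
    (T.post b).nodes = T.nodes := by
  cases T <;> simp [nodes]

@[simp] theorem nodes_relabel (φ : I → J) (hφ : ∀ i, G (φ i) = F i) (T : Tree Q F x d) :
    (T.relabel φ hφ).nodes = T.nodes.map φ := by
  induction T with
  | leaf k a => simp [nodes, relabel]
  | node i g h b ch ih =>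
    simp only [nodes, relabel, ih, Multiset.map_cons]
    congr 1
    exact (map_sum (Multiset.mapAddMonoidHom φ) _ _).symm

theorem nodes_graft (s : ∀ k, Tree Q F x (y k)) (T : Tree Q F y d) :
    (T.graft s).nodes = T.nodes + (T.leaves.map fun k => (s k).nodes).sum := by
  induction T with
  | leaf k a => simp [graft, nodes, leaves]
  | node i g h b ch ih =>
    simp only [graft, nodes, leaves, ih, Finset.sum_add_distrib, Multiset.cons_add]
    congr 2
    let A : Multiset K →+ Multiset I :=
      Multiset.sumAddMonoidHom.comp (Multiset.mapAddMonoidHom fun k => (s k).nodes)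
    exact (map_sum A _ _).symm

theorem nodes_subst (S : ∀ i, Tree Q G (F i).src (F i).tgt)
    (hS : ∀ i, (S i).leaves = Finset.univ.val) (T : Tree Q F x d) :
    (T.subst S).nodes = (T.nodes.map fun i => (S i).nodes).sum := by
  induction T with
  | leaf k a => simp [subst, nodes]
  | node i g h b ch ih =>
    subst h
    simp only [subst, nodes, nodes_post, nodes_graft, hS, Multiset.map_cons, Multiset.sum_cons, ih]
    congr 1
    let A : Multiset I →+ Multiset J :=
      Multiset.sumAddMonoidHom.comp (Multiset.mapAddMonoidHom fun k => (S k).nodes)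
    exact (map_sum A _ _).symm

theorem map_univ_eq_sum {n : ℕ} {A : Type} (f : Fin n → A) :
    (Finset.univ.val.map f) = ∑ i, {f i} := by
  have h : (fun i => ({f i} : Multiset A)) = (fun a => {a}) ∘ f := rfl
  rw [Finset.sum, h, ← Multiset.map_map, Multiset.sum_map_singleton]

theorem leaves_eval (T : Tree Q F x d) :
    (Finset.univ.val.map T.eval.lab) = T.leaves := by
  have key : ∀ {k : ℕ} {y : Fin k → Q.Obj} {d : Q.Obj} (f : Q.Arr y d)
      (e : ∀ j, LArr Q x (y j)), Finset.univ.val.map (LArr.comp f e).lab =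
        ∑ j, Finset.univ.val.map (e j).lab := by
    intro k y d f e
    simp only [map_univ_eq_sum]
    have h1 := Equiv.sum_comp (split (m := fun j => (e j).n))
      (fun q => ({(e q.1).lab q.2} : Multiset L))
    exact h1.trans (Fintype.sum_sigma _)
  induction T with
  | leaf k a => rfl
  | node i g h b ch ih =>
    refine (key _ _).trans ?_
    rw [Fin.sum_univ_one]
    refine (key _ _).trans ?_
    simp only [ih, leaves]

/-! Composites of trees. -/

theorem eval_post {d' : Q.Obj} (b : d ⟶ d') (T : Tree Q F x d) :
    LArr.Rel (T.post b).eval (LArr.comp (Q.ι b) fun _ : Fin 1 => T.eval) := by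
  cases T with
  | leaf l a => exact LArr.edge_comp l a b
  | node i g h c ch => exact LArr.ι_comp c b _

theorem eval_graft (s : ∀ k, Tree Q F x (y k)) (T : Tree Q F y d) :
    LArr.Rel (T.graft s).eval (LArr.bind T.eval fun k => (s k).eval) := by
  induction T with
  | leaf k a => exact eval_post a (s k)
  | node i g h b ch ih =>
    refine LArr.Rel.trans ?_ (LArr.bind_comp _ _ _)
    refine LArr.comp_congr _ fun _ => ?_
    exact (LArr.comp_congr _ ih).trans (LArr.bind_comp _ _ _)

/-- If each `F i` is the composite of `S i`, then replacing the nodes of a tree by the `S i` does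
not change the composite. -/
theorem eval_subst (S : ∀ i, Tree Q G (F i).src (F i).tgt)
    (hS : ∀ i, LArr.Rel (S i).eval (LArr.of (F i).arr)) (T : Tree Q F x d) :
    LArr.Rel (T.subst S).eval T.eval := by
  induction T with
  | leaf k a => exact LArr.Rel.refl _
  | node i g h b ch ih =>
    subst h
    refine (eval_post _ _).trans (LArr.comp_congr _ fun _ => ?_)
    exact (eval_graft _ _).trans (LArr.bind_congr (hS i) ih)

theorem eval_relabel (φ : I → J) (hφ : ∀ i, G (φ i) = F i) (T : Tree Q F x d) :
    (T.relabel φ hφ).eval = T.eval := by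
  induction T with
  | leaf k a => rfl
  | node i g h b ch ih => simp only [relabel, eval, ih]

theorem eval_corolla (i : I) (g : Elt Q) (h : F i = g) :
    LArr.Rel (corolla i g h).eval (LArr.of g.arr) :=
  ((LArr.comp_one g.arr).trans (LArr.one_comp _)).symm

theorem leaves_of_eval {g : Elt Q} {T : Tree Q F g.src g.tgt}
    (h : LArr.Rel T.eval (LArr.of g.arr)) : T.leaves = Finset.univ.val := by
  rw [← leaves_eval]
  obtain ⟨σ, h, -⟩ := h
  rw [map_univ_eq_sum, ← Equiv.sum_comp σ, ← map_univ_eq_sum]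
  conv_rhs => rw [← Multiset.map_id Finset.univ.val]
  exact Multiset.map_congr rfl fun i _ => (h i).symm

end Tree

end SymMulticat

namespace SymMulticat

variable {Q : SymMulticat.{u, v, w}}

/-! ### The category of elements -/

/-- A morphism `g ⟶ g'` in the category of elements of `Q`, regarded as a functor
`(F C)ᵒᵖ × C ⥤ Set` where `F C` is the free symmetric strict monoidal category on the category `C`
of objects: a permutation `σ` and morphisms `a i : s(g')_{σ(i)} ⟶ s(g)_i` and `b : t(g) ⟶ t(g')`
such that `g'` is `ι(b) ∘ g ∘ (ι(a_1), …, ι(a_m))` with its inputs permuted according to `σ`,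
the input of `a i` becoming the input of `g'` in position `σ i`. -/
structure Elt.Hom (g g' : Elt Q) where
  σ : Fin g.n ≃ Fin g'.n
  a : ∀ i, g'.src (σ i) ⟶ g.src i
  b : g.tgt ⟶ g'.tgt
  eq : LArr.Rel
    (LArr.comp (Q.ι b) fun _ : Fin 1 =>
      LArr.comp g.arr fun i => LArr.edge (x := g'.src) (σ i) (a i))
    (LArr.of g'.arr)

namespace Elt

/-- The tree with one node labelled `g`, edges labelled by the components of a morphism
`α : g ⟶ g'`, and leaves numbered according to its permutation. -/
def Hom.tree {g g' : Elt Q} (α : Hom g g') : Tree Q (fun _ : Fin 1 => g) g'.src g'.tgt :=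
  Tree.node 0 g rfl α.b fun i => Tree.leaf (α.σ i) (α.a i)

theorem Hom.eval_tree {g g' : Elt Q} (α : Hom g g') :
    LArr.Rel α.tree.eval (LArr.of g'.arr) := α.eq

theorem Hom.ext' {g g' : Elt Q} {α β : Hom g g'} (hσ : α.σ = β.σ) (ha : HEq α.a β.a)
    (hb : α.b = β.b) : α = β := by
  cases α; cases β; cases hσ; cases hb; cases ha; rfl

theorem Hom.subst_tree {g g' g'' : Elt Q} (α : Hom g g') (β : Hom g' g'') :
    (β.tree.subst fun _ => α.tree) =
      Tree.node 0 g rfl (α.b ≫ β.b) fun i => Tree.leaf (β.σ (α.σ i)) (β.a (α.σ i) ≫ α.a i) := by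
  simp [tree, Tree.subst, Tree.graft]

instance : Category (Elt Q) where
  Hom := Hom
  id g :=
    { σ := Equiv.refl _
      a := fun _ => 𝟙 _
      b := 𝟙 _
      eq := Tree.eval_corolla (F := fun _ : Fin 1 => g) 0 g rfl }
  comp {g g' g''} α β :=
    { σ := α.σ.trans β.σ
      a := fun i => β.a (α.σ i) ≫ α.a i
      b := α.b ≫ β.b
      eq := by
        have h := (Tree.eval_subst (fun _ => α.tree) (fun _ => α.eval_tree) β.tree).trans
          β.eval_tree
        rw [Hom.subst_tree] at h
        exact h }
  id_comp α := Hom.ext' rfl (heq_of_eq (by funext i; exact Category.comp_id _))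
    (Category.id_comp _)
  comp_id α := Hom.ext' rfl (heq_of_eq (by funext i; exact Category.id_comp _))
    (Category.comp_id _)
  assoc α β γ := Hom.ext' rfl (heq_of_eq (by funext i; exact (Category.assoc _ _ _).symm))
    (Category.assoc _ _ _)

end Elt

/-! ### The slice of a symmetric multicategory -/

variable (Q) in
/-- The arrows of the slice: the ways of composing `F 1, …, F n` to yield `f`.  These are the trees
with nodes labelled by `F 1, …, F n`, each number `1, …, n` occurring exactly once, together with a
numbering of the leaves by the inputs of `f`, such that the composite of the tree, with its inputs
permuted according to the numbering of the leaves, is `f`. -/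
def SliceArr {n : ℕ} (F : Fin n → Elt Q) (f : Elt Q) : Type (max u v w) :=
  {T : Tree Q F f.src f.tgt // T.nodes = Finset.univ.val ∧ LArr.Rel T.eval (LArr.of f.arr)}

namespace SliceArr

/-- Renumber the nodes. -/
def act {n m : ℕ} {F : Fin m → Elt Q} {F' : Fin n → Elt Q} {f : Elt Q} (σ : Fin n ≃ Fin m)
    (h : ∀ i, F' i = F (σ i)) (T : SliceArr Q F f) : SliceArr Q F' f :=
  ⟨T.1.relabel σ.symm fun i => by simp [h], by
    rw [Tree.nodes_relabel, T.2.1]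
    exact congrArg Finset.val (Finset.map_univ_equiv σ.symm), by
    rw [Tree.eval_relabel]
    exact T.2.2⟩

/-- Replace the node number `i` of `T` by the tree `S i`. -/
def comp {k : ℕ} {F : Fin k → Elt Q} {f : Elt Q} {m : Fin k → ℕ} {z : ∀ i, Fin (m i) → Elt Q}
    (T : SliceArr Q F f) (S : ∀ i, SliceArr Q (z i) (F i)) :
    SliceArr Q (fun p : Fin (∑ i, m i) => z (split p).1 (split p).2) f :=
  ⟨T.1.subst fun i => (S i).1.relabel (fun j => split.symm ⟨i, j⟩) (src_split z i), by
    rw [Tree.nodes_subst, T.2.1]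
    · simp only [Tree.nodes_relabel, (S _).2.1]
      change (∑ i, (Finset.univ.val.map fun j => (split (m := m)).symm ⟨i, j⟩ :
        Multiset (Fin (∑ i, m i)))) = _
      simp_rw [Tree.map_univ_eq_sum]
      rw [← Finset.sum_multiset_singleton, ← Equiv.sum_comp (split (m := m)).symm]
      exact (Fintype.sum_sigma
        (fun q => ({split.symm q} : Multiset (Fin (∑ i, m i))))).symm
    · intro i
      rw [← Tree.leaves_of_eval (S i).2.2, ← Tree.leaves_eval, ← Tree.leaves_eval,
        Tree.eval_relabel], by
    refine (Tree.eval_subst _ (fun i => ?_) _).trans T.2.2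
    rw [Tree.eval_relabel]
    exact (S i).2.2⟩

/-- The one-node tree of a morphism of elements. -/
def ofHom {g g' : Elt Q} (α : g ⟶ g') : SliceArr Q (fun _ : Fin 1 => g) g' :=
  ⟨Elt.Hom.tree α, by simp [Elt.Hom.tree, Tree.nodes], Elt.Hom.eval_tree α⟩

end SliceArr

variable (Q) in
/-- The slice `Q⁺`. -/
def slice : SymMulticat.{max u w, v, max u v w} where
  Obj := Elt Q
  Arr F f := SliceArr Q F f
  ι α := SliceArr.ofHom α
  comp T S := T.comp S
  act σ h T := T.act σ h
  one_comp f := by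
    apply Subtype.ext
    change ((Tree.corolla _ _ _).subst _) = f.1.relabel _ _
    rw [Tree.subst_corolla]
    rfl
  comp_one f := by
    apply Subtype.ext
    change f.1.subst (fun i => (Tree.corolla _ _ _).relabel _ _) = f.1.relabel _ _
    simp only [Tree.relabel_corolla]
    exact Tree.subst_eq_relabel _ _ _
  comp_assoc {_ _ _ _ z _ t} f g h := by
    apply Subtype.ext
    change (f.1.subst _).subst _ = (f.1.subst _).relabel _ _
    rw [Tree.subst_subst, Tree.relabel_subst]
    congr 1
    funext i
    change ((g i).1.relabel _ _).subst _ = ((g i).1.subst _ |>.relabel _ _).relabel _ _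
    rw [Tree.relabel_subst, Tree.relabel_subst]
    apply Tree.subst_relabel
    intro j
    obtain ⟨q, hq⟩ := (split (m := _)).surjective (⟨i, j⟩ : Σ i, Fin _)
    obtain rfl : (split q).1 = i := congrArg Sigma.fst hq
    obtain rfl : (split q).2 = j := eq_of_heq (Sigma.mk.inj hq).2
    refine (Tree.cast_apply (fun q => z (split q).1 (split q).2)
      (fun q => (h (split q).1 (split q).2).1.relabel (fun j => split.symm ⟨q, j⟩)
        (src_split (fun q => t (split q).1 (split q).2) q)) (split.symm_apply_apply q) _ rfl).trans ?_
    rw [Tree.relabel_relabel, Tree.relabel_relabel]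
    refine Tree.relabel_congr (fun l => ?_) _ _ _
    rw [eq_comm, Equiv.symm_apply_eq]
    apply split.injective
    rw [split_assoc, Equiv.apply_symm_apply, Equiv.apply_symm_apply]
  act_refl f := by
    apply Subtype.ext
    exact Tree.relabel_id _ _ (fun i => rfl) _
  act_act σ σ' h h' f := by
    apply Subtype.ext
    exact Tree.relabel_relabel _ _ _ _ _
  act_comp {_ _ x _ _ z} σ f g := by
    apply Subtype.ext
    change (f.1.relabel _ _).subst _ = (f.1.subst _).relabel _ _
    rw [Tree.relabel_subst]
    apply Tree.subst_relabel
    intro j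
    obtain ⟨i, rfl⟩ := σ.surjective j
    refine (Tree.cast_apply (fun i => x (σ i)) (fun i => (g (σ i)).1.relabel
      (fun j => split.symm ⟨i, j⟩) (src_split (fun i => z (σ i)) i))
      (σ.symm_apply_apply i) _ rfl).trans ?_
    rw [Tree.relabel_relabel]
    refine Tree.relabel_congr (fun l => ?_) _ _ _
    rw [eq_comm, Equiv.symm_apply_eq]
    apply split.injective
    rw [split_block, Equiv.apply_symm_apply, Equiv.apply_symm_apply]
  comp_act f g σ h := by
    apply Subtype.ext
    change f.1.subst (fun i => ((g i).1.relabel _ _).relabel _ _) = (f.1.subst _).relabel _ _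
    rw [Tree.relabel_subst]
    congr 1
    funext i
    rw [Tree.relabel_relabel, Tree.relabel_relabel]
    refine Tree.relabel_congr (fun l => ?_) _ _ _
    rw [eq_comm, Equiv.symm_apply_eq]
    apply split.injective
    rw [split_juxt, Equiv.apply_symm_apply, Equiv.apply_symm_apply, Equiv.apply_symm_apply]
  ι_comp α β := by
    apply Subtype.ext
    simp only [SliceArr.comp, SliceArr.act, SliceArr.ofHom, Elt.Hom.tree, Tree.subst,
      Tree.relabel, Tree.graft, Tree.post_node, Tree.post_leaf]
    rfl

end SymMulticat

/-! ### Generalised multicategories -/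

/-- A generalised multicategory.  For `f ∘_p g`, the bijection `amalg` identifies the sources of `f`
other than `p`, together with the sources of `g`, with the sources of the composite; its two
components are the amalgamating maps `ψ[f,g,p]` and `φ[f,g,p]`. -/
structure GenMulticat where
  /-- objects -/
  Obj : Type u
  /-- arrows -/
  Arr : Type w
  /-- the length of the source of an arrow -/
  arity : Arr → ℕ
  /-- the source of an arrow, as a list of length `arity f` -/
  src : ∀ f : Arr, Fin (arity f) → Obj
  /-- the target of an arrow -/
  tgt : Arr → Obj
  /-- the composite `f ∘_p g` -/
  comp : ∀ (f g : Arr) (p : Fin (arity f)), tgt g = src f p → Arr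
  /-- the amalgamating maps -/
  amalg : ∀ (f g : Arr) (p : Fin (arity f)) (h : tgt g = src f p),
    {i : Fin (arity f) // i ≠ p} ⊕ Fin (arity g) ≃ Fin (arity (comp f g p h))
  /-- the identity arrow of an object -/
  one : Obj → Arr
  tgt_comp : ∀ f g p h, tgt (comp f g p h) = tgt f
  src_comp_inl : ∀ f g p h i, src (comp f g p h) (amalg f g p h (.inl i)) = src f i.1
  src_comp_inr : ∀ f g p h j, src (comp f g p h) (amalg f g p h (.inr j)) = src g j
  arity_one : ∀ x, arity (one x) = 1
  src_one : ∀ x i, src (one x) i = x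
  tgt_one : ∀ x, tgt (one x) = x
  one_comp : ∀ f y p h, comp (one y) f p h = f
  amalg_one_comp : ∀ f y p h j, (amalg (one y) f p h (.inr j) : ℕ) = j
  comp_one : ∀ f x p h, comp f (one x) p h = f
  amalg_comp_one_inl : ∀ f x p h i, (amalg f (one x) p h (.inl i) : ℕ) = i.1
  amalg_comp_one_inr : ∀ f x p h j, (amalg f (one x) p h (.inr j) : ℕ) = p
  assoc : ∀ (f g k : Arr) (p : Fin (arity f)) (q : Fin (arity g)) (h₁ : tgt g = src f p)
    (h₂ : tgt k = src g q) (h₃ : tgt k = src (comp f g p h₁) (amalg f g p h₁ (.inr q)))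
    (h₄ : tgt (comp g k q h₂) = src f p),
    comp (comp f g p h₁) k (amalg f g p h₁ (.inr q)) h₃ = comp f (comp g k q h₂) p h₄
  amalg_assoc_left : ∀ (f g k : Arr) (p : Fin (arity f)) (q : Fin (arity g)) (h₁ : tgt g = src f p)
    (h₂ : tgt k = src g q) (h₃ : tgt k = src (comp f g p h₁) (amalg f g p h₁ (.inr q)))
    (h₄ : tgt (comp g k q h₂) = src f p) (i : Fin (arity f)) (hi : i ≠ p)
    (hi' : amalg f g p h₁ (.inl ⟨i, hi⟩) ≠ amalg f g p h₁ (.inr q)),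
    (amalg (comp f g p h₁) k (amalg f g p h₁ (.inr q)) h₃
        (.inl ⟨amalg f g p h₁ (.inl ⟨i, hi⟩), hi'⟩) : ℕ) =
      amalg f (comp g k q h₂) p h₄ (.inl ⟨i, hi⟩)
  amalg_assoc_middle : ∀ (f g k : Arr) (p : Fin (arity f)) (q : Fin (arity g))
    (h₁ : tgt g = src f p)
    (h₂ : tgt k = src g q) (h₃ : tgt k = src (comp f g p h₁) (amalg f g p h₁ (.inr q)))
    (h₄ : tgt (comp g k q h₂) = src f p) (j : Fin (arity g)) (hj : j ≠ q)
    (hj' : amalg f g p h₁ (.inr j) ≠ amalg f g p h₁ (.inr q)),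
    (amalg (comp f g p h₁) k (amalg f g p h₁ (.inr q)) h₃
        (.inl ⟨amalg f g p h₁ (.inr j), hj'⟩) : ℕ) =
      amalg f (comp g k q h₂) p h₄ (.inr (amalg g k q h₂ (.inl ⟨j, hj⟩)))
  amalg_assoc_right : ∀ (f g k : Arr) (p : Fin (arity f)) (q : Fin (arity g))
    (h₁ : tgt g = src f p)
    (h₂ : tgt k = src g q) (h₃ : tgt k = src (comp f g p h₁) (amalg f g p h₁ (.inr q)))
    (h₄ : tgt (comp g k q h₂) = src f p) (l : Fin (arity k)),
    (amalg (comp f g p h₁) k (amalg f g p h₁ (.inr q)) h₃ (.inr l) : ℕ) =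
      amalg f (comp g k q h₂) p h₄ (.inr (amalg g k q h₂ (.inr l)))
  comm : ∀ (f g k : Arr) (p q : Fin (arity f)) (hpq : p ≠ q) (hqp : q ≠ p) (h₁ : tgt g = src f p)
    (h₂ : tgt k = src f q)
    (h₃ : tgt k = src (comp f g p h₁) (amalg f g p h₁ (.inl ⟨q, hqp⟩)))
    (h₄ : tgt g = src (comp f k q h₂) (amalg f k q h₂ (.inl ⟨p, hpq⟩))),
    comp (comp f g p h₁) k (amalg f g p h₁ (.inl ⟨q, hqp⟩)) h₃ =
      comp (comp f k q h₂) g (amalg f k q h₂ (.inl ⟨p, hpq⟩)) h₄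
  amalg_comm_left : ∀ (f g k : Arr) (p q : Fin (arity f)) (hpq : p ≠ q) (hqp : q ≠ p)
    (h₁ : tgt g = src f p) (h₂ : tgt k = src f q)
    (h₃ : tgt k = src (comp f g p h₁) (amalg f g p h₁ (.inl ⟨q, hqp⟩)))
    (h₄ : tgt g = src (comp f k q h₂) (amalg f k q h₂ (.inl ⟨p, hpq⟩)))
    (i : Fin (arity f)) (hp : i ≠ p) (hq : i ≠ q)
    (hp' : amalg f g p h₁ (.inl ⟨i, hp⟩) ≠ amalg f g p h₁ (.inl ⟨q, hqp⟩))
    (hq' : amalg f k q h₂ (.inl ⟨i, hq⟩) ≠ amalg f k q h₂ (.inl ⟨p, hpq⟩)),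
    (amalg (comp f g p h₁) k (amalg f g p h₁ (.inl ⟨q, hqp⟩)) h₃
        (.inl ⟨amalg f g p h₁ (.inl ⟨i, hp⟩), hp'⟩) : ℕ) =
      amalg (comp f k q h₂) g (amalg f k q h₂ (.inl ⟨p, hpq⟩)) h₄
        (.inl ⟨amalg f k q h₂ (.inl ⟨i, hq⟩), hq'⟩)
  amalg_comm_middle : ∀ (f g k : Arr) (p q : Fin (arity f)) (hpq : p ≠ q) (hqp : q ≠ p)
    (h₁ : tgt g = src f p) (h₂ : tgt k = src f q)
    (h₃ : tgt k = src (comp f g p h₁) (amalg f g p h₁ (.inl ⟨q, hqp⟩)))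
    (h₄ : tgt g = src (comp f k q h₂) (amalg f k q h₂ (.inl ⟨p, hpq⟩)))
    (j : Fin (arity g))
    (hj : amalg f g p h₁ (.inr j) ≠ amalg f g p h₁ (.inl ⟨q, hqp⟩)),
    (amalg (comp f g p h₁) k (amalg f g p h₁ (.inl ⟨q, hqp⟩)) h₃
        (.inl ⟨amalg f g p h₁ (.inr j), hj⟩) : ℕ) =
      amalg (comp f k q h₂) g (amalg f k q h₂ (.inl ⟨p, hpq⟩)) h₄ (.inr j)
  amalg_comm_right : ∀ (f g k : Arr) (p q : Fin (arity f)) (hpq : p ≠ q) (hqp : q ≠ p)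
    (h₁ : tgt g = src f p) (h₂ : tgt k = src f q)
    (h₃ : tgt k = src (comp f g p h₁) (amalg f g p h₁ (.inl ⟨q, hqp⟩)))
    (h₄ : tgt g = src (comp f k q h₂) (amalg f k q h₂ (.inl ⟨p, hpq⟩)))
    (l : Fin (arity k))
    (hl : amalg f k q h₂ (.inr l) ≠ amalg f k q h₂ (.inl ⟨p, hpq⟩)),
    (amalg (comp f g p h₁) k (amalg f g p h₁ (.inl ⟨q, hqp⟩)) h₃ (.inr l) : ℕ) =
      amalg (comp f k q h₂) g (amalg f k q h₂ (.inl ⟨p, hpq⟩)) h₄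
        (.inl ⟨amalg f k q h₂ (.inr l), hl⟩)

namespace GenMulticat

variable (M : GenMulticat.{u, w})

/-- An arrow of `M` with target `d`, its inputs labelled by elements of `X`, an input labelled by
`l` being of type `x l`. -/
structure MLab {X : Type} (x : X → M.Obj) (d : M.Obj) where
  arr : M.Arr
  lab : Fin (M.arity arr) → X
  tgt_eq : M.tgt arr = d
  src_eq : ∀ i, M.src arr i = x (lab i)

variable {M}

namespace MLab

variable {X Y K L N : Type} {x : X → M.Obj} {y : Y → M.Obj} {d : M.Obj}

theorem ext' {α β : MLab M x d} (h : α.arr = β.arr)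
    (hl : ∀ (i : Fin (M.arity α.arr)) (j : Fin (M.arity β.arr)), (i : ℕ) = j → α.lab i = β.lab j) : α = β := by
  obtain ⟨f, l, _, _⟩ := α
  obtain ⟨g, l', _, _⟩ := β
  dsimp only at h hl
  subst h
  obtain rfl : l = l' := funext fun i => hl i i rfl
  rfl

theorem lab_congr {α β : MLab M x d} (h : α = β) (i : Fin (M.arity α.arr))
    (j : Fin (M.arity β.arr)) (hij : (i : ℕ) = j) : α.lab i = β.lab j := by
  subst h
  rw [Fin.ext hij]

/-- Change the labels. -/
def map (φ : X → Y) (hφ : ∀ l, y (φ l) = x l) (α : MLab M x d) : MLab M y d :=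
  ⟨α.arr, fun i => φ (α.lab i), α.tgt_eq, fun i => (α.src_eq i).trans (hφ _).symm⟩

/-- The identity arrow of `d`, with its only input labelled `l`. -/
def pure (l : X) (h : x l = d) : MLab M x d :=
  ⟨M.one d, fun _ => l, M.tgt_one d, fun i => (M.src_one d i).trans h.symm⟩

/-- The composite `α ∘_p β`, its inputs being labelled according to the amalgamating maps. -/
def psub (α : MLab M x d) (p : Fin (M.arity α.arr)) {c : M.Obj} (β : MLab M x c)
    (h : c = M.src α.arr p) : MLab M x d where
  arr := M.comp α.arr β.arr p (β.tgt_eq.trans h)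
  lab i := Sum.elim (fun j => α.lab j.1) β.lab
    ((M.amalg α.arr β.arr p (β.tgt_eq.trans h)).symm i)
  tgt_eq := (M.tgt_comp _ _ _ _).trans α.tgt_eq
  src_eq i := by
    obtain ⟨s, rfl⟩ := (M.amalg α.arr β.arr p (β.tgt_eq.trans h)).surjective i
    rw [Equiv.symm_apply_apply]
    cases s with
    | inl s => exact (M.src_comp_inl _ _ _ _ _).trans (α.src_eq _)
    | inr s => exact (M.src_comp_inr _ _ _ _ _).trans (β.src_eq _)

/-- The position in `α ∘_p β` of the input `i ≠ p` of `α`. -/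
def ψ (α : MLab M x d) (p : Fin (M.arity α.arr)) {c : M.Obj} (β : MLab M x c)
    (h : c = M.src α.arr p) (i : Fin (M.arity α.arr)) (hi : i ≠ p) :
    Fin (M.arity (α.psub p β h).arr) :=
  M.amalg α.arr β.arr p (β.tgt_eq.trans h) (.inl ⟨i, hi⟩)

/-- The position in `α ∘_p β` of the input `j` of `β`. -/
def φ (α : MLab M x d) (p : Fin (M.arity α.arr)) {c : M.Obj} (β : MLab M x c)
    (h : c = M.src α.arr p) (j : Fin (M.arity β.arr)) :
    Fin (M.arity (α.psub p β h).arr) :=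
  M.amalg α.arr β.arr p (β.tgt_eq.trans h) (.inr j)

section
variable (α : MLab M x d) (p : Fin (M.arity α.arr)) {c : M.Obj} (β : MLab M x c)
    (h : c = M.src α.arr p)

@[simp] theorem lab_ψ (i : Fin (M.arity α.arr)) (hi : i ≠ p) :
    (α.psub p β h).lab (α.ψ p β h i hi) = α.lab i := by
  simp [psub, ψ]

@[simp] theorem lab_φ (j : Fin (M.arity β.arr)) :
    (α.psub p β h).lab (α.φ p β h j) = β.lab j := by
  simp [psub, φ]

theorem src_ψ (i : Fin (M.arity α.arr)) (hi : i ≠ p) :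
    M.src (α.psub p β h).arr (α.ψ p β h i hi) = M.src α.arr i :=
  M.src_comp_inl _ _ _ _ _

theorem src_φ (j : Fin (M.arity β.arr)) :
    M.src (α.psub p β h).arr (α.φ p β h j) = M.src β.arr j :=
  M.src_comp_inr _ _ _ _ _

theorem ψ_injective {i i' : Fin (M.arity α.arr)} {hi : i ≠ p} {hi' : i' ≠ p}
    (e : α.ψ p β h i hi = α.ψ p β h i' hi') : i = i' :=
  congrArg Subtype.val (Sum.inl.inj ((M.amalg α.arr β.arr p (β.tgt_eq.trans h)).injective e))

theorem φ_injective {j j' : Fin (M.arity β.arr)}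
    (e : α.φ p β h j = α.φ p β h j') : j = j' :=
  Sum.inr.inj ((M.amalg α.arr β.arr p (β.tgt_eq.trans h)).injective e)

theorem ψ_ne_φ (i : Fin (M.arity α.arr)) (hi : i ≠ p) (j : Fin (M.arity β.arr)) :
    α.ψ p β h i hi ≠ α.φ p β h j := fun e =>
  Sum.inl_ne_inr ((M.amalg α.arr β.arr p (β.tgt_eq.trans h)).injective e)

theorem pos_cases (k : Fin (M.arity (α.psub p β h).arr)) :
    (∃ i hi, k = α.ψ p β h i hi) ∨ ∃ j, k = α.φ p β h j := by
  obtain ⟨s, rfl⟩ := (M.amalg α.arr β.arr p (β.tgt_eq.trans h)).surjective k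
  cases s with
  | inl s => exact .inl ⟨s.1, s.2, rfl⟩
  | inr s => exact .inr ⟨s, rfl⟩

theorem sum_lab {A : Type} [AddCommMonoid A] (f : X → A) :
    ∑ i, f ((α.psub p β h).lab i) + f (α.lab p) = ∑ i, f (α.lab i) + ∑ j, f (β.lab j) := by
  have e := Equiv.sum_comp (M.amalg α.arr β.arr p (β.tgt_eq.trans h))
    (fun i => f ((α.psub p β h).lab i))
  rw [Fintype.sum_sum_type] at e
  have e1 : ∀ i : {i // i ≠ p}, (α.psub p β h).lab
      (M.amalg α.arr β.arr p (β.tgt_eq.trans h) (.inl i)) = α.lab i.1 :=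
    fun i => lab_ψ α p β h i.1 i.2
  have e2 : ∀ j, (α.psub p β h).lab
      (M.amalg α.arr β.arr p (β.tgt_eq.trans h) (.inr j)) = β.lab j :=
    fun j => lab_φ α p β h j
  simp only [e1, e2] at e
  refine (congrArg (· + f (α.lab p)) e.symm).trans ?_
  rw [add_right_comm]
  congr 1
  rw [← Fintype.sum_subtype_add_sum_subtype (fun i => i ≠ p) (fun i => f (α.lab i))]
  congr 1
  have : Unique {i // ¬ (i ≠ p)} := ⟨⟨⟨p, by simp⟩⟩, fun i => Subtype.ext (not_not.1 i.2)⟩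
  rw [Fintype.sum_unique]
  congr 2
  exact (not_not.1 (default : {i // ¬ (i ≠ p)}).2).symm

end

theorem psub_assoc (α : MLab M x d) (p : Fin (M.arity α.arr)) {c : M.Obj} (β : MLab M x c)
    (h : c = M.src α.arr p) (q : Fin (M.arity β.arr)) {c' : M.Obj} (γ : MLab M x c')
    (h' : c' = M.src β.arr q) :
    (α.psub p β h).psub (α.φ p β h q) γ (h'.trans (src_φ α p β h q).symm) =
      α.psub p (β.psub q γ h') h := by
  refine ext' (M.assoc _ _ _ _ _ _ (γ.tgt_eq.trans h') _ _) fun i j hij => ?_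
  rcases pos_cases _ _ _ _ i with ⟨i, hi, rfl⟩ | ⟨i, rfl⟩
  · rcases pos_cases _ _ _ _ i with ⟨i, hi', rfl⟩ | ⟨i, rfl⟩
    · obtain rfl : α.ψ p (β.psub q γ h') h i hi' = j :=
        Fin.ext ((M.amalg_assoc_left _ _ _ _ _ _ (γ.tgt_eq.trans h') _ _ _ _ hi).symm.trans hij)
      simp
    · have hiq : i ≠ q := fun e => hi (by rw [e])
      obtain rfl : α.φ p (β.psub q γ h') h (β.ψ q γ h' i hiq) = j :=
        Fin.ext ((M.amalg_assoc_middle _ _ _ _ _ _ (γ.tgt_eq.trans h') _ _ _ _ hi).symm.trans hij)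
      simp
  · obtain rfl : α.φ p (β.psub q γ h') h (β.φ q γ h' i) = j :=
      Fin.ext ((M.amalg_assoc_right _ _ _ _ _ _ (γ.tgt_eq.trans h') _ _ _).symm.trans hij)
    simp

theorem psub_comm (α : MLab M x d) (p : Fin (M.arity α.arr)) {c : M.Obj} (β : MLab M x c)
    (h : c = M.src α.arr p) (q : Fin (M.arity α.arr)) {c' : M.Obj} (γ : MLab M x c')
    (h' : c' = M.src α.arr q) (hqp : q ≠ p) :
    (α.psub p β h).psub (α.ψ p β h q hqp) γ (h'.trans (src_ψ α p β h q hqp).symm) =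
      (α.psub q γ h').psub (α.ψ q γ h' p hqp.symm) β
        (h.trans (src_ψ α q γ h' p hqp.symm).symm) := by
  refine ext' (M.comm _ _ _ _ _ hqp.symm hqp _ (γ.tgt_eq.trans h') _ _) fun i j hij => ?_
  rcases pos_cases _ _ _ _ i with ⟨i, hi, rfl⟩ | ⟨i, rfl⟩
  · rcases pos_cases _ _ _ _ i with ⟨i, hi', rfl⟩ | ⟨i, rfl⟩
    · have hiq : i ≠ q := by rintro rfl; exact hi rfl
      have hne : α.ψ q γ h' i hiq ≠ α.ψ q γ h' p hqp.symm :=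
        fun e => hi' (ψ_injective _ _ _ _ e)
      obtain rfl : (α.psub q γ h').ψ (α.ψ q γ h' p hqp.symm) β
          (h.trans (src_ψ α q γ h' p hqp.symm).symm) (α.ψ q γ h' i hiq) hne = j :=
        Fin.ext ((M.amalg_comm_left _ _ _ _ _ _ _ _ _ _ _ _ _ _ hi _).symm.trans hij)
      simp
    · obtain rfl : (α.psub q γ h').φ (α.ψ q γ h' p hqp.symm) β
          (h.trans (src_ψ α q γ h' p hqp.symm).symm) i = j :=
        Fin.ext ((M.amalg_comm_middle _ _ _ _ _ _ _ _ (γ.tgt_eq.trans h') _ _ _ hi).symm.trans hij)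
      simp
  · have hne : α.φ q γ h' i ≠ α.ψ q γ h' p hqp.symm := (ψ_ne_φ _ _ _ _ _ _ _).symm
    obtain rfl : (α.psub q γ h').ψ (α.ψ q γ h' p hqp.symm) β
          (h.trans (src_ψ α q γ h' p hqp.symm).symm) (α.φ q γ h' i) hne = j :=
      Fin.ext ((M.amalg_comm_right _ _ _ _ _ _ _ _ _ _ _ _ hne).symm.trans hij)
    simp

theorem psub_one (α : MLab M x d) (p : Fin (M.arity α.arr)) {c : M.Obj} (l : X) (hl : x l = c)
    (h : c = M.src α.arr p) (hlab : α.lab p = l) : α.psub p (pure l hl) h = α := by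
  refine ext' (M.comp_one _ _ _ _) fun i j hij => ?_
  rcases pos_cases _ _ _ _ i with ⟨i, hi, rfl⟩ | ⟨i, rfl⟩
  · obtain rfl : i = j := Fin.ext ((M.amalg_comp_one_inl _ _ _ _ _).symm.trans hij)
    simp
  · obtain rfl : p = j := Fin.ext ((M.amalg_comp_one_inr _ _ _ _ _).symm.trans hij)
    exact (lab_φ α p (pure l hl) h i).trans hlab.symm

theorem one_psub (l : X) (h : x l = d) (p : Fin (M.arity (pure (M := M) l h).arr))
    {c : M.Obj} (β : MLab M x c) (h' : c = M.src (pure (M := M) l h).arr p) (hc : c = d) :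
    (pure l h).psub p β h' = hc ▸ β := by
  subst hc
  refine ext' (M.one_comp _ _ _ _) fun i j hij => ?_
  rcases pos_cases _ _ _ _ i with ⟨i, hi, rfl⟩ | ⟨i, rfl⟩
  · have h1 : M.arity (pure (M := M) l h).arr = 1 := M.arity_one _
    exact absurd (Fin.ext (by omega)) hi
  · obtain rfl : i = j := Fin.ext ((M.amalg_one_comp _ _ _ _ _).symm.trans hij)
    simp

@[simp] theorem map_psub (θ : X → Y) (hθ : ∀ l, y (θ l) = x l) (α : MLab M x d)
    (p : Fin (M.arity α.arr)) {c : M.Obj} (β : MLab M x c) (h : c = M.src α.arr p) :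
    (α.psub p β h).map θ hθ = (α.map θ hθ).psub p (β.map θ hθ) h := by
  refine ext' rfl fun i j hij => ?_
  obtain rfl := Fin.ext hij
  rcases pos_cases α p β h i with ⟨i, hi, rfl⟩ | ⟨i, rfl⟩
  · exact (congrArg θ (lab_ψ α p β h i hi)).trans (lab_ψ (α.map θ hθ) p (β.map θ hθ) h i hi).symm
  · exact (congrArg θ (lab_φ α p β h i)).trans (lab_φ (α.map θ hθ) p (β.map θ hθ) h i).symm

end MLab

end GenMulticat

namespace GenMulticat

variable {M : GenMulticat.{u, w}}

namespace MLab

variable {X Y K L N : Type} {x : X → M.Obj} {y : Y → M.Obj} {k : K → M.Obj} {l : L → M.Obj}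
  {n : N → M.Obj} {d : M.Obj}

@[simp] theorem map_map (θ : X → Y) (hθ : ∀ l, y (θ l) = x l) (θ' : Y → L)
    (hθ' : ∀ i, l (θ' i) = y i) (α : MLab M x d) :
    (α.map θ hθ).map θ' hθ' = α.map (fun i => θ' (θ i)) (fun i => (hθ' _).trans (hθ i)) := rfl

theorem cast_apply {A : Type} (Z : A → M.Obj) (P : ∀ a, MLab M l (Z a)) {c : M.Obj} {a b : A}
    (hab : a = b) (e : Z a = c) (e' : Z b = c) : (e ▸ P a : MLab M l c) = e' ▸ P b := by
  subst hab
  rfl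

theorem map_congr {θ θ' : X → Y} (h : ∀ i, θ i = θ' i) (hθ : ∀ l, y (θ l) = x l)
    (hθ' : ∀ l, y (θ' l) = x l) (α : MLab M x d) : α.map θ hθ = α.map θ' hθ' := by
  obtain rfl : θ = θ' := funext h
  rfl

/-- One step of simultaneous composition: compose, in an input whose label has a rule, with the
labelled arrow given by the rule. -/
def Step (R : ∀ i, MLab M x (x i) → Prop) (α γ : MLab M x d) : Prop :=
  ∃ (p : Fin (M.arity α.arr)) (i : X) (hi : α.lab p = i) (β : MLab M x (x i)), R i β ∧
    γ = α.psub p β ((congrArg x hi.symm).trans (α.src_eq p).symm)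

/-- Several steps. -/
abbrev Steps (R : ∀ i, MLab M x (x i) → Prop) : MLab M x d → MLab M x d → Prop :=
  Relation.ReflTransGen (Step R)

theorem Step.map {R : ∀ i, MLab M x (x i) → Prop} {R' : ∀ i, MLab M y (y i) → Prop}
    {θ : X → Y} {hθ : ∀ i, y (θ i) = x i}
    (hR : ∀ i β, R i β → R' (θ i) ((hθ i).symm ▸ β.map θ hθ)) {α γ : MLab M x d}
    (h : Step R α γ) : Step R' (α.map θ hθ) (γ.map θ hθ) := by
  obtain ⟨p, i, hi, β, hβ, rfl⟩ := h
  refine ⟨p, θ i, congrArg θ hi, _, hR i β hβ, ?_⟩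
  rw [map_psub]
  have : ∀ {c c' : M.Obj} (e : c = c') (β : MLab M y c) (α : MLab M y d) (p) (h : c = _) (h' : c' = _),
      α.psub p β h = α.psub p (e ▸ β) h' := by
    intro c c' e β α p h h'
    subst e
    rfl
  exact this _ _ _ _ _ _

theorem Steps.map {R : ∀ i, MLab M x (x i) → Prop} {R' : ∀ i, MLab M y (y i) → Prop}
    {θ : X → Y} {hθ : ∀ i, y (θ i) = x i}
    (hR : ∀ i β, R i β → R' (θ i) ((hθ i).symm ▸ β.map θ hθ)) {α γ : MLab M x d}
    (h : Steps R α γ) : Steps R' (α.map θ hθ) (γ.map θ hθ) :=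
  Relation.ReflTransGen.lift (MLab.map θ hθ) (fun _ _ => Step.map hR) _ _ h

theorem Step.psub {R : ∀ i, MLab M x (x i) → Prop} (α : MLab M x d) (p : Fin (M.arity α.arr))
    {c : M.Obj} {β γ : MLab M x c} (h : c = M.src α.arr p) (hs : Step R β γ) :
    Step R (α.psub p β h) (α.psub p γ h) := by
  obtain ⟨q, i, hi, δ, hδ, rfl⟩ := hs
  exact ⟨α.φ p β h q, i, (lab_φ _ _ _ _ _).trans hi, δ, hδ, (psub_assoc _ _ _ _ _ _ _).symm⟩

theorem Steps.psub {R : ∀ i, MLab M x (x i) → Prop} (α : MLab M x d) (p : Fin (M.arity α.arr))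
    {c : M.Obj} {β γ : MLab M x c} (h : c = M.src α.arr p) (hs : Steps R β γ) :
    Steps R (α.psub p β h) (α.psub p γ h) :=
  Relation.ReflTransGen.lift (fun β => α.psub p β h) (fun _ _ => Step.psub α p h) _ _ hs

/-- Labelled arrows in which no label has a rule have no further steps, so the result of
simultaneous composition does not depend on the order of the steps. -/
theorem Steps.unique {R : ∀ i, MLab M x (x i) → Prop}
    (hR : ∀ i β γ, R i β → R i γ → β = γ) {α β γ : MLab M x d} (h : Steps R α β) (h' : Steps R α γ)
    (hβ : ∀ p δ, ¬ R (β.lab p) δ) (hγ : ∀ p δ, ¬ R (γ.lab p) δ) : β = γ := by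
  have key : ∀ a b c : MLab M x d, Step R a b → Step R a c →
      ∃ e, Relation.ReflGen (Step R) b e ∧ Relation.ReflTransGen (Step R) c e := by
    rintro a _ _ ⟨p, i, hi, β, hβ, rfl⟩ ⟨q, j, hj, γ, hγ, rfl⟩
    by_cases hqp : q = p
    · subst hqp
      subst hi
      subst hj
      obtain rfl := hR _ _ _ hβ hγ
      exact ⟨_, .refl, .refl⟩
    · refine ⟨_, .single ⟨a.ψ p β _ q hqp, j, (lab_ψ _ _ _ _ _ _).trans hj, γ, hγ, rfl⟩,
        .single ⟨a.ψ q γ _ p (Ne.symm hqp), i, (lab_ψ _ _ _ _ _ _).trans hi, β, hβ, ?_⟩⟩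
      exact psub_comm _ _ _ _ _ _ _ _
  obtain ⟨δ, h1, h2⟩ := Relation.church_rosser key h h'
  have nf : ∀ {a : MLab M x d}, (∀ p δ, ¬ R (a.lab p) δ) → Relation.ReflTransGen (Step R) a δ →
      a = δ := by
    intro a ha hs
    rcases Relation.ReflTransGen.cases_head hs with h | ⟨b, ⟨p, i, hi, β, hβ, -⟩, -⟩
    · exact h
    · subst hi
      exact absurd hβ (ha _ _)
  exact (nf hβ h1).trans (nf hγ h2).symm

theorem Steps.sum_eq {A : Type} [AddCommMonoid A] [IsCancelAdd A]
    {R : ∀ i, MLab M x (x i) → Prop} (f : X → A)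
    (hf : ∀ i β, R i β → f i = ∑ j, f (β.lab j)) {α γ : MLab M x d} (h : Steps R α γ) :
    ∑ i, f (γ.lab i) = ∑ i, f (α.lab i) := by
  induction h with
  | refl => rfl
  | tail _ hs ih =>
    rw [← ih]
    obtain ⟨p, i, hi, β, hβ, rfl⟩ := hs
    subst hi
    have := sum_lab _ p β (src_eq _ p).symm f
    rw [hf _ β hβ] at this
    exact add_right_cancel this

/-- The rules for substituting the arrows `s i`: the labels of type `K` are those still to be
substituted for, those of type `L` are the labels of the result. -/
def Rule (s : ∀ i, MLab M l (k i)) :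
    ∀ i : K ⊕ L, MLab M (Sum.elim k l) (Sum.elim k l i) → Prop
  | .inl i, β => β = (s i).map Sum.inr fun _ => rfl
  | .inr _, _ => False

theorem Rule.unique (s : ∀ i, MLab M l (k i)) : ∀ i β γ, Rule s i β → Rule s i γ → β = γ
  | .inl _, _, _, h, h' => h.trans h'.symm
  | .inr _, _, _, h, _ => h.elim

/-- `γ` is the result of composing `α` with the arrow `s i` in each input labelled `i`. -/
def IsBind (α : MLab M k d) (s : ∀ i, MLab M l (k i)) (γ : MLab M l d) : Prop :=
  Steps (Rule s) (α.map Sum.inl fun _ => rfl) (γ.map Sum.inr fun _ => rfl)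

theorem map_inr_injective {α β : MLab M l d}
    (h : (α.map Sum.inr fun _ => rfl : MLab M (Sum.elim k l) d) = β.map Sum.inr fun _ => rfl) :
    α = β :=
  ext' (congrArg MLab.arr h :) fun i j hij =>
    Sum.inr_injective (lab_congr h i j hij)

theorem IsBind.unique {α : MLab M k d} {s : ∀ i, MLab M l (k i)} {γ γ' : MLab M l d}
    (h : IsBind α s γ) (h' : IsBind α s γ') : γ = γ' :=
  map_inr_injective (Steps.unique (Rule.unique s) h h' (fun _ _ h => h) (fun _ _ h => h))

theorem exists_steps (s : ∀ i, MLab M l (k i)) (m : ℕ) (α : MLab M (Sum.elim k l) d)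
    (hm : ∑ i, Sum.elim (fun _ => 1) (fun _ => 0) (α.lab i) = m) :
    ∃ γ : MLab M l d, Steps (Rule s) α (γ.map Sum.inr fun _ => rfl) := by
  induction m generalizing α with
  | zero =>
    have h0 : ∀ i, ∃ j, α.lab i = Sum.inr j := by
      intro i
      have := (Finset.sum_eq_zero_iff.1 hm) i (Finset.mem_univ i)
      cases h : α.lab i with
      | inl j => rw [h] at this; simp at this
      | inr j => exact ⟨j, rfl⟩
    choose j hj using h0
    refine ⟨⟨α.arr, j, α.tgt_eq, fun i => by rw [α.src_eq, hj]; rfl⟩, ?_⟩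
    convert Relation.ReflTransGen.refl
    refine ext' rfl fun i i' hi => ?_
    obtain rfl := Fin.ext hi
    exact (hj i).symm
  | succ m ih =>
    have : ∃ p j, α.lab p = Sum.inl j := by
      by_contra hne
      push Not at hne
      have : ∑ i, Sum.elim (fun _ => 1) (fun _ => 0) (α.lab i) = 0 := by
        refine Finset.sum_eq_zero fun i _ => ?_
        cases h : α.lab i with
        | inl j => exact absurd h (hne i j)
        | inr j => rfl
      omega
    obtain ⟨p, j, hp⟩ := this
    let β : MLab M (Sum.elim k l) (Sum.elim k l (Sum.inl j)) := (s j).map Sum.inr fun _ => rfl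
    have hβ : Sum.elim k l (Sum.inl j) = M.src α.arr p :=
      (congrArg (Sum.elim k l) hp.symm).trans (α.src_eq p).symm
    have h1 := sum_lab α p β hβ (Sum.elim (fun _ => 1) (fun _ => 0))
    rw [hm, hp] at h1
    have h2 : ∑ j, Sum.elim (fun _ : K => 1) (fun _ : L => 0) (β.lab j) = 0 :=
      Finset.sum_eq_zero fun i _ => rfl
    rw [h2] at h1
    obtain ⟨γ, hγ⟩ := ih (α.psub p β hβ) (by simpa using h1)
    exact ⟨γ, .head ⟨p, .inl j, hp, β, rfl, rfl⟩ hγ⟩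

theorem exists_isBind (α : MLab M k d) (s : ∀ i, MLab M l (k i)) : ∃ γ, IsBind α s γ :=
  exists_steps s _ _ rfl

/-- The simultaneous composite: the result of composing `α` with the arrow `s i` in each input
labelled `i`, one input after another. -/
noncomputable def bind (α : MLab M k d) (s : ∀ i, MLab M l (k i)) : MLab M l d :=
  (exists_isBind α s).choose

theorem isBind_bind (α : MLab M k d) (s : ∀ i, MLab M l (k i)) : IsBind α s (bind α s) :=
  (exists_isBind α s).choose_spec

theorem IsBind.eq {α : MLab M k d} {s : ∀ i, MLab M l (k i)} {γ : MLab M l d}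
    (h : IsBind α s γ) : bind α s = γ := (isBind_bind α s).unique h

theorem pure_bind (i : K) (s : ∀ i, MLab M l (k i)) : bind (pure i rfl) s = s i := by
  apply IsBind.eq
  have hp : 0 < M.arity (M.one (k i)) := by rw [M.arity_one]; exact Nat.one_pos
  refine .single ⟨⟨0, hp⟩, .inl i, rfl, _, rfl, ?_⟩
  exact (one_psub (x := Sum.elim k l) (.inl i) rfl ⟨0, hp⟩ _ _ rfl).symm

theorem sum_bind {A : Type} [AddCommMonoid A] [IsCancelAdd A] (f : L → A) (α : MLab M k d)
    (s : ∀ i, MLab M l (k i)) :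
    ∑ i, f ((bind α s).lab i) = ∑ i, ∑ j, f ((s (α.lab i)).lab j) := by
  have h := Steps.sum_eq (Sum.elim (fun i => ∑ j, f ((s i).lab j)) f) ?_ (isBind_bind α s)
  · exact h
  · rintro (i | i) β hβ
    · obtain rfl : β = _ := hβ
      rfl
    · exact hβ.elim

theorem map_bind (θ : L → N) (hθ : ∀ i, n (θ i) = l i) (α : MLab M k d)
    (s : ∀ i, MLab M l (k i)) : (bind α s).map θ hθ = bind α fun i => (s i).map θ hθ := by
  symm
  apply IsBind.eq
  have h := Steps.map (R' := Rule fun i => (s i).map θ hθ) (θ := Sum.map id θ)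
    (hθ := by rintro (i | i); exacts [rfl, hθ i]) ?_ (isBind_bind α s)
  · exact h
  · rintro (i | i) β hβ
    · obtain rfl : β = _ := hβ
      rfl
    · exact hβ.elim

theorem bind_map (θ : N → K) (hθ : ∀ i, k (θ i) = n i) (α : MLab M n d)
    (s : ∀ i, MLab M l (k i)) (s' : ∀ i, MLab M l (n i)) (hs : ∀ i, s' i = hθ i ▸ s (θ i)) :
    bind (α.map θ hθ) s = bind α s' := by
  apply IsBind.eq
  have h := Steps.map (R' := Rule s) (θ := Sum.map θ id)
    (hθ := by rintro (i | i); exacts [hθ i, rfl]) ?_ (isBind_bind α s')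
  · exact h
  · rintro (i | i) β hβ
    · obtain rfl : β = _ := hβ
      rw [hs]
      have : ∀ {c c' : M.Obj} (e : c = c') (γ : MLab M l c),
          e.symm ▸ ((e ▸ γ : MLab M l c').map Sum.inr (fun _ => rfl) : MLab M (Sum.elim k l) c') =
            γ.map Sum.inr (fun _ => rfl) := by
        intro c c' e γ
        subst e
        rfl
      exact this (hθ i) (s (θ i))
    · exact hβ.elim

theorem bind_pure (α : MLab M k d) : bind α (fun i => pure i rfl) = α := by
  let c : K ⊕ K → K := Sum.elim id id
  have hc : ∀ i, k (c i) = Sum.elim k k i := by rintro (i | i) <;> rfl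
  have key : ∀ {β γ : MLab M (Sum.elim k k) d}, Steps (Rule fun i => pure i rfl) β γ →
      γ.map c hc = β.map c hc := by
    intro β γ h
    induction h with
    | refl => rfl
    | tail _ hs ih =>
      rw [← ih]
      obtain ⟨p, (i | i), hi, δ, hδ, rfl⟩ := hs
      · obtain rfl : δ = _ := hδ
        rw [map_psub]
        exact psub_one (MLab.map c hc _) p i rfl _ (congrArg c hi)
      · exact hδ.elim
  exact key (isBind_bind α fun i => pure i rfl)

theorem bind_assoc (α : MLab M k d) (s : ∀ i, MLab M l (k i)) (t : ∀ i, MLab M n (l i)) :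
    bind (bind α s) t = bind α fun i => bind (s i) t := by
  -- all the steps take place among arrows labelled by `K ⊕ L ⊕ N`
  let z : K ⊕ (L ⊕ N) → M.Obj := Sum.elim k (Sum.elim l n)
  let R : ∀ i, MLab M z (z i) → Prop
    | .inl i, β => β = (s i).map (fun j => .inr (.inl j)) fun _ => rfl
    | .inr (.inl i), β => β = (t i).map (fun j => .inr (.inr j)) fun _ => rfl
    | .inr (.inr _), _ => False
  have hR : ∀ i β γ, R i β → R i γ → β = γ := by
    rintro (i | i | i) β γ h h'
    exacts [h.trans h'.symm, h.trans h'.symm, h.elim]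
  have hl : ∀ {c : M.Obj} (α : MLab M l c), Steps R (α.map (fun j => .inr (.inl j)) fun _ => rfl)
      ((bind α t).map (fun j => .inr (.inr j)) fun _ => rfl) := by
    intro c α
    refine Steps.map (R := Rule t) (θ := Sum.inr) (hθ := fun _ => rfl) ?_ (isBind_bind α t)
    rintro (i | i) β hβ
    · obtain rfl : β = _ := hβ
      rfl
    · exact hβ.elim
  have h1 : Steps R (α.map Sum.inl fun _ => rfl)
      ((bind α s).map (fun j => .inr (.inl j)) fun _ => rfl) := by
    refine Steps.map (θ := Sum.map id Sum.inl) (hθ := by rintro (i | i) <;> rfl) ?_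
      (isBind_bind α s)
    rintro (i | i) β hβ
    · obtain rfl : β = _ := hβ
      rfl
    · exact hβ.elim
  have h2 : Steps R (α.map Sum.inl fun _ => rfl)
      ((bind α fun i => bind (s i) t).map (fun j => .inr (.inr j)) fun _ => rfl) := by
    have key : ∀ {β γ : MLab M (Sum.elim k n) d}, Step (Rule fun i => bind (s i) t) β γ →
        Steps R (β.map (y := z) (Sum.map id Sum.inr) (by rintro (i | i) <;> rfl))
          (γ.map (Sum.map id Sum.inr) (by rintro (i | i) <;> rfl)) := by
      rintro β _ ⟨p, (i | i), hi, δ, hδ, rfl⟩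
      · obtain rfl : δ = _ := hδ
        rw [map_psub]
        refine .trans (.single ⟨p, .inl i, congrArg (Sum.map id Sum.inr) hi, _, rfl, rfl⟩) ?_
        exact Steps.psub _ _ _ (hl (s i))
      · exact hδ.elim
    have := isBind_bind α fun i => bind (s i) t
    have h3 : ∀ {β γ : MLab M (Sum.elim k n) d}, Steps (Rule fun i => bind (s i) t) β γ →
        Steps R (β.map (y := z) (Sum.map id Sum.inr) (by rintro (i | i) <;> rfl))
          (γ.map (Sum.map id Sum.inr) (by rintro (i | i) <;> rfl)) := by
      intro β γ h
      induction h with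
      | refl => exact .refl
      | tail _ hs ih => exact ih.trans (key hs)
    exact h3 this
  have h3 := Steps.unique hR (h1.trans (hl _)) h2 (fun _ _ h => h) (fun _ _ h => h)
  refine ext' (congrArg MLab.arr h3 :) fun i j hij => ?_
  exact Sum.inr_injective (Sum.inr_injective (lab_congr h3 i j hij))

end MLab

end GenMulticat

namespace GenMulticat

variable (M : GenMulticat.{u, w})

/-! ### The symmetric multicategory of a generalised multicategory -/

/-- An element `(f, σ)` of `ξ(M)(x_1, …, x_n; y)`: a bijection `σ` and an arrow
`f : (x_{σ(1)}, …, x_{σ(n)}) ⟶ y` of `M`, given as an arrow `f` with its inputs labelled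
bijectively by `1, …, n`, the input `i` having the label `σ(i)`. -/
def XiArr {n : ℕ} (x : Fin n → Discrete M.Obj) (y : Discrete M.Obj) : Type w :=
  {α : MLab M (fun i => (x i).as) y.as // Function.Bijective α.lab}

variable {M}

namespace XiArr

theorem bijective_iff {m n : ℕ} (f : Fin m → Fin n) :
    Function.Bijective f ↔ ∑ i, ({f i} : Multiset (Fin n)) = Finset.univ.val := by
  rw [← SymMulticat.Tree.map_univ_eq_sum]
  constructor
  · intro h
    exact congrArg Finset.val (Finset.map_univ_equiv (Equiv.ofBijective f h))
  · intro h
    constructor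
    · have : (Finset.univ.val.map f).Nodup := h ▸ Finset.univ.nodup
      intro a b hab
      exact Multiset.inj_on_of_nodup_map this a (Finset.mem_univ a) b (Finset.mem_univ b) hab
    · intro b
      have : b ∈ Finset.univ.val.map f := h ▸ Finset.mem_univ b
      obtain ⟨a, -, ha⟩ := Multiset.mem_map.1 this
      exact ⟨a, ha⟩

/-- The symmetric action `(f, τ) σ = (f, σ⁻¹ τ)`. -/
def act {n m : ℕ} {x : Fin m → Discrete M.Obj} {x' : Fin n → Discrete M.Obj} {y : Discrete M.Obj}
    (σ : Fin n ≃ Fin m) (h : ∀ i, x' i = x (σ i)) (α : XiArr M x y) : XiArr M x' y :=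
  ⟨α.1.map σ.symm fun i => by simp [h], σ.symm.bijective.comp α.2⟩

/-- The arrow `(1_x, ι)`. -/
def one {x y : Discrete M.Obj} (h : x = y) : XiArr M (fun _ : Fin 1 => x) y :=
  ⟨MLab.pure 0 (congrArg Discrete.as h), by
    have h1 : M.arity (M.one y.as) = 1 := M.arity_one _
    constructor
    · intro a b _
      have ha : (a : ℕ) < M.arity (M.one y.as) := a.2
      have hb : (b : ℕ) < M.arity (M.one y.as) := b.2
      exact Fin.ext (by omega)
    · intro b
      exact ⟨⟨0, by change 0 < M.arity (M.one y.as); omega⟩, Subsingleton.elim _ _⟩⟩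

/-- Composition. -/
noncomputable def comp {k : ℕ} {x : Fin k → Discrete M.Obj} {y : Discrete M.Obj} {m : Fin k → ℕ}
    {z : ∀ i, Fin (m i) → Discrete M.Obj} (α : XiArr M x y) (β : ∀ i, XiArr M (z i) (x i)) :
    XiArr M (fun p : Fin (∑ i, m i) => z (split p).1 (split p).2) y :=
  ⟨MLab.bind α.1 fun i => (β i).1.map (fun j => split.symm ⟨i, j⟩) fun j =>
      congrArg Discrete.as (src_split z i j), by
    rw [bijective_iff, MLab.sum_bind (fun l => ({l} : Multiset _))]
    have h1 : ∀ i, ∑ j, ({((β i).1.map (fun j => split.symm ⟨i, j⟩)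
        (fun j => congrArg Discrete.as (src_split z i j)) :
          MLab M (fun p : Fin (∑ i, m i) => (z (split p).1 (split p).2).as) (x i).as).lab j} :
        Multiset (Fin (∑ i, m i))) = ∑ j, {split.symm ⟨i, j⟩} := fun i =>
      Equiv.sum_comp (Equiv.ofBijective _ (β i).2)
        (fun j => ({split.symm ⟨i, j⟩} : Multiset (Fin (∑ i, m i))))
    simp only [h1]
    refine (Equiv.sum_comp (Equiv.ofBijective _ α.2)
      (fun i => ∑ j, ({split.symm ⟨i, j⟩} : Multiset (Fin (∑ i, m i))))).trans ?_
    rw [← Finset.sum_multiset_singleton, ← Equiv.sum_comp (split (m := m)).symm]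
    exact (Fintype.sum_sigma
      (fun q => ({split.symm q} : Multiset (Fin (∑ i, m i))))).symm⟩

end XiArr

variable (M) in
/-- The symmetric multicategory `ξ(M)`. -/
noncomputable def xi : SymMulticat.{u, u, w} where
  Obj := Discrete M.Obj
  Arr x y := XiArr M x y
  ι a := XiArr.one (Discrete.ext (Discrete.eq_of_hom a))
  comp α β := α.comp β
  act σ h α := α.act σ h
  one_comp f := by
    apply Subtype.ext
    exact MLab.pure_bind _ _
  comp_one f := by
    apply Subtype.ext
    dsimp only [XiArr.comp, XiArr.act]
    conv_rhs => rw [← MLab.bind_pure f.1]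
    rw [MLab.map_bind]
    rfl
  comp_assoc {_ _ _ _ z _ t} f g h := by
    apply Subtype.ext
    dsimp only [XiArr.comp, XiArr.act]
    rw [MLab.map_bind, MLab.bind_assoc]
    congr 1
    funext i
    rw [MLab.map_bind, MLab.map_bind]
    apply MLab.bind_map
    intro j
    obtain ⟨q, hq⟩ := (split (m := _)).surjective (⟨i, j⟩ : Σ i, Fin _)
    obtain rfl : (split q).1 = i := congrArg Sigma.fst hq
    obtain rfl : (split q).2 = j := eq_of_heq (Sigma.mk.inj hq).2
    symm
    refine (MLab.cast_apply (fun q => (z (split q).1 (split q).2).as)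
      (fun q => (h (split q).1 (split q).2).1.map (fun j => split.symm ⟨q, j⟩) (fun j =>
        congrArg Discrete.as (src_split (fun q => t (split q).1 (split q).2) q j)))
      (split.symm_apply_apply q) _ rfl).trans ?_
    rw [MLab.map_map, MLab.map_map]
    refine MLab.map_congr (fun l => ?_) _ _ _
    rw [eq_comm, Equiv.symm_apply_eq]
    apply split.injective
    rw [split_assoc, Equiv.apply_symm_apply, Equiv.apply_symm_apply]
  act_refl f := rfl
  act_act σ σ' h h' f := rfl
  act_comp {_ _ x _ _ z} σ f g := by
    apply Subtype.ext
    dsimp only [XiArr.comp, XiArr.act]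
    rw [MLab.map_bind]
    apply MLab.bind_map
    intro i
    obtain ⟨i, rfl⟩ := σ.surjective i
    symm
    refine (MLab.cast_apply (fun i => (x (σ i)).as) (fun i => (g (σ i)).1.map
      (fun j => split.symm ⟨i, j⟩) (fun j =>
        congrArg Discrete.as (src_split (fun i => z (σ i)) i j)))
      (σ.symm_apply_apply i) _ rfl).trans ?_
    rw [MLab.map_map]
    refine MLab.map_congr (fun l => ?_) _ _ _
    rw [eq_comm, Equiv.symm_apply_eq]
    apply split.injective
    rw [split_block, Equiv.apply_symm_apply, Equiv.apply_symm_apply]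
  comp_act f g σ h := by
    apply Subtype.ext
    dsimp only [XiArr.comp, XiArr.act]
    rw [MLab.map_bind]
    congr 1
    funext i
    rw [MLab.map_map, MLab.map_map]
    refine MLab.map_congr (fun l => ?_) _ _ _
    rw [eq_comm, Equiv.symm_apply_eq]
    apply split.injective
    rw [split_juxt, Equiv.apply_symm_apply, Equiv.apply_symm_apply, Equiv.apply_symm_apply]
  ι_comp a b := by
    apply Subtype.ext
    obtain rfl := Discrete.ext (Discrete.eq_of_hom b)
    exact MLab.pure_bind _ _

end GenMulticat

namespace SymMulticat.Tree

variable {Q : SymMulticat.{u, v, w}} {I J H : Type} {F : I → Elt Q} {G : J → Elt Q}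
  {E : H → Elt Q} {L : Type} {x : L → Q.Obj} {d : Q.Obj}

/-- Transport along an equality of arrows. -/
def castE {g g' : Elt Q} (e : g = g') (T : Tree Q F g.src g.tgt) : Tree Q F g'.src g'.tgt :=
  e ▸ T

@[simp] theorem castE_rfl {g : Elt Q} (e : g = g) (T : Tree Q F g.src g.tgt) : castE e T = T := rfl

@[simp] theorem castE_castE {g g' g'' : Elt Q} (e : g = g') (e' : g' = g'')
    (T : Tree Q F g.src g.tgt) : castE e' (castE e T) = castE (e.trans e') T := by
  subst e'; subst e; rfl

theorem castE_shift {g g' k : Elt Q} (e : g = k) (e' : g' = k) {T : Tree Q F g.src g.tgt}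
    {T' : Tree Q F g'.src g'.tgt} (h : castE e T = castE e' T') :
    castE (e.trans e'.symm) T = T' := by
  subst e; subst e'; exact h

theorem castE_split {g g' k : Elt Q} (e : g = k) (e' : g = g') (T : Tree Q F g.src g.tgt) :
    castE e T = castE (e'.symm.trans e) (castE e' T) := by
  subst e'; rfl

@[simp] theorem subst_castE {g g' : Elt Q} (e : g = g') (T : Tree Q F g.src g.tgt)
    (S : ∀ i, Tree Q G (F i).src (F i).tgt) : (castE e T).subst S = castE e (T.subst S) := by
  subst e; rfl

@[simp] theorem relabel_castE {g g' : Elt Q} (e : g = g') (T : Tree Q F g.src g.tgt)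
    (φ : I → J) (hφ : ∀ i, G (φ i) = F i) :
    (castE e T).relabel φ hφ = castE e (T.relabel φ hφ) := by
  subst e; rfl

@[simp] theorem nodes_castE {g g' : Elt Q} (e : g = g') (T : Tree Q F g.src g.tgt) :
    (castE e T).nodes = T.nodes := by
  subst e; rfl

@[simp] theorem castE_corolla {g g' : Elt Q} (e : g = g') (i : I) (h : F i = g) :
    castE e (corolla i g h) = corolla i g' (h.trans e) := by
  subst e; rfl

theorem castE_eval {g g' : Elt Q} (e : g = g') (T : Tree Q F g.src g.tgt)
    (h : LArr.Rel T.eval (LArr.of g.arr)) : LArr.Rel (castE e T).eval (LArr.of g'.arr) := by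
  subst e; exact h

theorem subst_corolla' (S : ∀ i, Tree Q G (F i).src (F i).tgt) (i : I) (g : Elt Q) (h : F i = g) :
    (corolla i g h).subst S = castE h (S i) := by
  subst h
  exact subst_corolla S i

theorem subst_relabel' (φ : I → J) (hφ : ∀ i, G (φ i) = F i)
    (S : ∀ i, Tree Q E (G i).src (G i).tgt) (T : Tree Q F x d) :
    (T.relabel φ hφ).subst S = T.subst fun i => castE (hφ i) (S (φ i)) :=
  subst_relabel φ hφ S _ (fun _ => rfl) T

theorem relabel_injective (φ : I → J) (hφ : ∀ i, G (φ i) = F i) (hinj : Function.Injective φ)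
    (T T' : Tree Q F x d) (h : T.relabel φ hφ = T'.relabel φ hφ) : T = T' := by
  induction T with
  | leaf l a =>
    cases T' with
    | leaf l' a' => simpa [relabel] using h
    | node => simp [relabel] at h
  | node i g hg b ch ih =>
    cases T' with
    | leaf => simp [relabel] at h
    | node i' g' hg' b' ch' =>
      simp only [relabel, node.injEq] at h
      obtain ⟨hi, rfl, hb, hch⟩ := h
      obtain rfl := hinj hi
      obtain rfl := eq_of_heq hb
      have hch := eq_of_heq hch
      congr 1
      funext j
      exact ih j _ (congrFun hch j)

/-- Replace node `p` by the tree `S` and leave the other nodes, renumbered by `u`, as they are. -/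
def pick [DecidableEq I] (F : I → Elt Q) (p : I) (u : ∀ i, i ≠ p → J)
    (hu : ∀ i hi, G (u i hi) = F i) (S : Tree Q G (F p).src (F p).tgt) (i : I) :
    Tree Q G (F i).src (F i).tgt :=
  if hi : i = p then castE (congrArg F hi.symm) S else corolla (u i hi) (F i) (hu i hi)

theorem pick_self [DecidableEq I] (p : I) (u : ∀ i, i ≠ p → J)
    (hu : ∀ i hi, G (u i hi) = F i) (S : Tree Q G (F p).src (F p).tgt) :
    pick F p u hu S p = S := by
  simp [pick]

theorem pick_ne [DecidableEq I] (p : I) (u : ∀ i, i ≠ p → J)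
    (hu : ∀ i hi, G (u i hi) = F i) (S : Tree Q G (F p).src (F p).tgt) (i : I) (hi : i ≠ p) :
    pick F p u hu S i = corolla (u i hi) (F i) (hu i hi) := by
  simp [pick, hi]

end SymMulticat.Tree

namespace GenMulticat

open SymMulticat (Tree SliceArr Elt LArr)

variable (M : GenMulticat.{u, w})

/-! ### The slice of a generalised multicategory -/

/-- The arrow `f` of `M`, as the arrow `(f, ι)` of `ξ(M)`. -/
def std (f : M.Arr) : Elt M.xi where
  n := M.arity f
  src i := ⟨M.src f i⟩
  tgt := ⟨M.tgt f⟩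
  arr := ⟨⟨f, id, rfl, fun _ => rfl⟩, Function.bijective_id⟩

/-- The configurations for composing the arrows `F 1, …, F n` of `M` to yield `f`: trees with nodes
labelled by `F 1, …, F n`, each number `1, …, n` occurring exactly once, and edges labelled by
objects (that is, by identities), together with a numbering of the leaves by the inputs of `f`,
such that `f` is the composite of the tree and the numbering is the permutation which this
composition induces on the sources. -/
abbrev Config {n : ℕ} (F : Fin n → M.Arr) (f : M.Arr) : Type (max u w) :=
  SliceArr M.xi (fun i => M.std (F i)) (M.std f)

/-- A choice, for every tree `T` of arrows of `M`, of a bijection `τ_T` from its set of nodes to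
`{1, …, n}`, given by singling out those configurations whose nodes are numbered by `τ_T`. -/
structure NodeOrder where
  /-- the nodes of `T` are numbered according to the chosen bijection -/
  Ordered : ∀ {n : ℕ} {F : Fin n → M.Arr} {f : M.Arr}, M.Config F f → Prop
  existsUnique : ∀ {n : ℕ} {F : Fin n → M.Arr} {f : M.Arr} (T : M.Config F f),
    ∃! e : Equiv.Perm (Fin n), Ordered (F := fun i => F (e i)) (T.act e fun _ => rfl)

variable {M} (τ : NodeOrder M)

/-- The arrows of the slice `M₊`: configurations with nodes numbered in the chosen way. -/
structure PlusArr where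
  n : ℕ
  F : Fin n → M.Arr
  f : M.Arr
  T : M.Config F f
  ord : τ.Ordered T

namespace PlusArr

variable {τ}

section
variable {K : Type} [Fintype K] (G : K → M.Arr) (f : M.Arr)
  (U : Tree M.xi (fun k => M.std (G k)) (M.std f).src (M.std f).tgt)
  (hU : U.nodes = Finset.univ.val) (hU' : LArr.Rel U.eval (LArr.of (M.std f).arr))

/-- A tree with nodes numbered bijectively by `K`, renumbered arbitrarily. -/
noncomputable def pre : M.Config (fun i => G ((Fintype.equivFin K).symm i)) f :=
  ⟨U.relabel (Fintype.equivFin K) fun i => by simp, by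
    rw [Tree.nodes_relabel, hU]
    exact congrArg Finset.val (Finset.map_univ_equiv (Fintype.equivFin K)), by
    rw [Tree.eval_relabel]
    exact hU'⟩

variable (τ)

/-- The chosen numbering of the nodes of a tree with nodes numbered bijectively by `K`. -/
noncomputable def enum : K ≃ Fin (Fintype.card K) :=
  (Fintype.equivFin K).trans (τ.existsUnique (pre G f U hU hU')).choose.symm

/-- A tree with nodes numbered bijectively by `K`, renumbered in the chosen way. -/
noncomputable abbrev ofTree : PlusArr τ where
  n := Fintype.card K
  F i := G ((enum τ G f U hU hU').symm i)
  f := f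
  T := (pre G f U hU hU').act (τ.existsUnique (pre G f U hU hU')).choose fun _ => rfl
  ord := (τ.existsUnique (pre G f U hU hU')).choose_spec.1

theorem ofTree_T : (ofTree τ G f U hU hU').T.1 =
    U.relabel (enum τ G f U hU hU') (fun i => by simp) :=
  Tree.relabel_relabel _ _ _ _ _

end

/-- An arrow of `M₊` is determined by its tree up to renumbering of the nodes. -/
theorem unique {A B : PlusArr τ} {K : Type} (G : K → M.Arr) (α : Fin A.n → K) (β : Fin B.n → K)
    (hα : ∀ i, G (α i) = A.F i) (hβ : ∀ i, G (β i) = B.F i) (iα : Function.Injective α)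
    (iβ : Function.Injective β) (hf : A.f = B.f)
    (h : Tree.castE (congrArg M.std hf)
        (A.T.1.relabel (G := fun k => M.std (G k)) α fun i => congrArg M.std (hα i)) =
      B.T.1.relabel β fun i => congrArg M.std (hβ i)) :
    A = B ∧ ∀ i j, α i = β j → (i : ℕ) = j := by
  have hn : Finset.univ.val.map α = Finset.univ.val.map β := by
    have := congrArg Tree.nodes h
    rwa [Tree.nodes_castE, Tree.nodes_relabel, Tree.nodes_relabel, A.T.2.1, B.T.2.1] at this
  obtain ⟨n, F, f, T, hT⟩ := A
  obtain ⟨n', F', f', T', hT'⟩ := B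
  dsimp only at α β hα hβ iα iβ hf h hn ⊢
  obtain rfl : n = n' := by simpa using congrArg Multiset.card hn
  subst hf
  have hex : ∀ j, ∃ i, α i = β j := by
    intro j
    have : β j ∈ Finset.univ.val.map α := hn ▸ Multiset.mem_map_of_mem β (Finset.mem_univ j)
    obtain ⟨i, -, hi⟩ := Multiset.mem_map.1 this
    exact ⟨i, hi⟩
  choose e he using hex
  have ie : Function.Injective e := fun j j' hj => iβ (by rw [← he, ← he, hj])
  let e' : Equiv.Perm (Fin n) := Equiv.ofBijective e (Finite.injective_iff_bijective.1 ie)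
  have he' : ∀ j, α (e' j) = β j := he
  clear_value e'
  obtain rfl : F' = fun j => F (e' j) := funext fun j => by rw [← hβ, ← hα, he']
  have hTT : T.act e' (fun _ => rfl) = T' := by
    apply Subtype.ext
    refine Tree.relabel_injective (G := fun k => M.std (G k)) β
      (fun i => congrArg M.std (hβ i)) iβ _ _ ?_
    rw [← h, Tree.castE_rfl]
    refine (Tree.relabel_relabel _ _ _ _ _).trans ?_
    refine Tree.relabel_congr (fun i => ?_) _ _ _
    rw [← he', Equiv.apply_symm_apply]
  subst hTT
  have h1 : SliceArr.act (Q := M.xi) (F' := fun i => M.std (F i)) (Equiv.refl _) (fun _ => rfl) T = T :=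
    Subtype.ext (Tree.relabel_id _ _ (fun _ => rfl) _)
  have h2 : e' = Equiv.refl _ := by
    refine (τ.existsUnique T).unique hT' ?_
    exact (congrArg τ.Ordered h1).mpr hT
  subst h2
  refine ⟨?_, fun i j hij => ?_⟩
  · congr 1
    exact h1.symm
  · rw [← he' j] at hij
    exact congrArg Fin.val (iα hij)

end PlusArr

end GenMulticat

namespace GenMulticat

open SymMulticat (Tree SliceArr Elt LArr)

variable {M : GenMulticat.{u, w}} {τ : NodeOrder M}

namespace PlusArr

section
variable (A B : PlusArr τ) (p : Fin A.n) (h : B.f = A.F p)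

/-- The labels of the nodes of `A` other than `p` and of the nodes of `B`. -/
abbrev compF : {i : Fin A.n // i ≠ p} ⊕ Fin B.n → M.Arr :=
  Sum.elim (fun i => A.F i.1) B.F

theorem compF_inl (i : {i : Fin A.n // i ≠ p}) : compF A B p (.inl i) = A.F i.1 := rfl

theorem compF_inr (j : Fin B.n) : compF A B p (.inr j) = B.F j := rfl

/-- What to put in place of the node `i` of `A`. -/
noncomputable def compPick : ∀ i, Tree M.xi (fun k => M.std (compF A B p k)) (M.std (A.F i)).src
    (M.std (A.F i)).tgt :=
  Tree.pick (fun i => M.std (A.F i)) p (fun i hi => .inl ⟨i, hi⟩)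
    (fun i hi => congrArg M.std (compF_inl A B p ⟨i, hi⟩))
    (Tree.castE (congrArg M.std h) (B.T.1.relabel Sum.inr fun j =>
      congrArg M.std (compF_inr A B p j)))

theorem eval_compPick (i : Fin A.n) :
    LArr.Rel (compPick A B p h i).eval (LArr.of (M.std (A.F i)).arr) := by
  by_cases hi : i = p
  · subst hi
    rw [compPick, Tree.pick_self]
    apply Tree.castE_eval
    rw [Tree.eval_relabel]
    exact B.T.2.2
  · rw [compPick, Tree.pick_ne _ _ _ _ _ hi]
    exact Tree.eval_corolla _ _ _

/-- The tree obtained from `A` by replacing the node `p` by the tree `B`. -/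
noncomputable def compTree : Tree M.xi (fun k => M.std (compF A B p k)) (M.std A.f).src (M.std A.f).tgt :=
  A.T.1.subst (compPick A B p h)

theorem nodes_compTree : (compTree A B p h).nodes = Finset.univ.val := by
  rw [compTree, Tree.nodes_subst _ (fun i => Tree.leaves_of_eval (eval_compPick A B p h i)),
    A.T.2.1]
  change ∑ i, (compPick A B p h i).nodes = _
  rw [← Fintype.sum_subtype_add_sum_subtype (fun i => i ≠ p)]
  rw [← Finset.sum_multiset_singleton, Fintype.sum_sum_type]
  congr 1
  · refine Finset.sum_congr rfl fun i _ => ?_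
    rw [compPick, Tree.pick_ne _ _ _ _ _ i.2]
    simp [Tree.corolla, Tree.nodes]
  · have : Unique {i // ¬ (i ≠ p)} := ⟨⟨⟨p, by simp⟩⟩, fun i => Subtype.ext (not_not.1 i.2)⟩
    rw [Fintype.sum_unique]
    have hp : (default : {i // ¬ (i ≠ p)}).1 = p := not_not.1 (default : {i // ¬ (i ≠ p)}).2
    rw [hp, compPick, Tree.pick_self, Tree.nodes_castE, Tree.nodes_relabel, B.T.2.1,
      Tree.map_univ_eq_sum]

theorem eval_compTree : LArr.Rel (compTree A B p h).eval (LArr.of (M.std A.f).arr) :=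
  (Tree.eval_subst _ (eval_compPick A B p h) _).trans A.T.2.2

/-- The composite `A ∘_p B`. -/
noncomputable def comp : PlusArr τ :=
  ofTree τ (compF A B p) A.f (compTree A B p h) (nodes_compTree A B p h) (eval_compTree A B p h)

/-- The amalgamating maps. -/
noncomputable def amalg : {i : Fin A.n // i ≠ p} ⊕ Fin B.n ≃ Fin (comp A B p h).n :=
  enum τ (compF A B p) A.f (compTree A B p h) (nodes_compTree A B p h) (eval_compTree A B p h)

end

/-- Labels for the nodes of a composite. -/
def lbl {a b c : ℕ} {p : Fin a} (e : {i : Fin a // i ≠ p} ⊕ Fin b ≃ Fin c) {K : Type}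
    (α : Fin a → K) (β : Fin b → K) (k : Fin c) : K :=
  Sum.elim (fun i => α i.1) β (e.symm k)

section
variable {a b c : ℕ} {p : Fin a} (e : {i : Fin a // i ≠ p} ⊕ Fin b ≃ Fin c) {K : Type}
  (α : Fin a → K) (β : Fin b → K)

@[simp] theorem lbl_inl (i : {i : Fin a // i ≠ p}) : lbl e α β (e (.inl i)) = α i.1 := by
  simp [lbl]

@[simp] theorem lbl_inr (j : Fin b) : lbl e α β (e (.inr j)) = β j := by
  simp [lbl]

variable {α β} in
theorem lbl_injective (iα : Function.Injective α) (iβ : Function.Injective β)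
    (h : ∀ i j, α i ≠ β j) : Function.Injective (lbl e α β) := by
  apply Function.Injective.comp _ (Equiv.injective _)
  exact (iα.comp Subtype.val_injective).sumElim iβ fun i j => h _ _

end

/-- `C` is the composite of `A` and `B` at `p`, with amalgamating maps `e`. -/
structure IsComp (A B : PlusArr τ) (p : Fin A.n) (h : B.f = A.F p) (C : PlusArr τ)
    (e : {i : Fin A.n // i ≠ p} ⊕ Fin B.n ≃ Fin C.n) : Prop where
  f : C.f = A.f
  inl : ∀ i, C.F (e (.inl i)) = A.F i.1
  inr : ∀ j, C.F (e (.inr j)) = B.F j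
  T : Tree.castE (congrArg M.std f) C.T.1 =
    A.T.1.subst (Tree.pick (G := fun k => M.std (C.F k)) (fun i => M.std (A.F i)) p
      (fun i hi => e (.inl ⟨i, hi⟩)) (fun i hi => congrArg M.std (inl ⟨i, hi⟩))
      (Tree.castE (congrArg M.std h) (B.T.1.relabel (G := fun k => M.std (C.F k))
        (fun j => e (.inr j)) fun j => congrArg M.std (inr j))))

/-- `O` is the one-node tree labelled `f`. -/
structure IsOne (g : M.Arr) (O : PlusArr τ) : Prop where
  f : O.f = g
  n : O.n = 1
  F : ∀ i, O.F i = g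
  T : ∀ i, Tree.castE (congrArg M.std f) O.T.1 =
    Tree.corolla (F := fun i => M.std (O.F i)) i (M.std _) (congrArg M.std (F i))

namespace IsComp

variable {A B C : PlusArr τ} {p : Fin A.n} {h : B.f = A.F p}
  {e : {i : Fin A.n // i ≠ p} ⊕ Fin B.n ≃ Fin C.n}

theorem lbl_F (H : IsComp A B p h C e) {K : Type} (G : K → M.Arr) {α : Fin A.n → K} {β : Fin B.n → K}
    (hα : ∀ i, G (α i) = A.F i) (hβ : ∀ j, G (β j) = B.F j) (k : Fin C.n) :
    G (lbl e α β k) = C.F k := by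
  obtain ⟨k | k, rfl⟩ := e.surjective k
  · rw [lbl_inl, H.inl, hα]
  · rw [lbl_inr, H.inr, hβ]

theorem subst (H : IsComp A B p h C e) {J : Type} {G : J → Elt M.xi}
    (S : ∀ k, Tree M.xi G (M.std (C.F k)).src (M.std (C.F k)).tgt) :
    Tree.castE (congrArg M.std H.f) (C.T.1.subst S) = A.T.1.subst fun i =>
      if hi : i = p then
        Tree.castE (congrArg M.std (h.trans (congrArg A.F hi.symm))) (B.T.1.subst fun j =>
          Tree.castE (congrArg M.std (H.inr j)) (S (e (.inr j))))
      else Tree.castE (congrArg M.std (H.inl ⟨i, hi⟩)) (S (e (.inl ⟨i, hi⟩))) := by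
  rw [← Tree.subst_castE, H.T]
  refine (Tree.subst_subst _ _ _).trans ?_
  congr 1
  funext i
  by_cases hi : i = p
  · subst hi
    rw [Tree.pick_self, dif_pos rfl, Tree.subst_castE, Tree.subst_relabel']
  · rw [Tree.pick_ne _ _ _ _ _ hi, dif_neg hi, Tree.subst_corolla']

theorem relabel (H : IsComp A B p h C e) {K : Type} (G : K → M.Arr) (α : Fin A.n → K) (β : Fin B.n → K)
    (hα : ∀ i, G (α i) = A.F i) (hβ : ∀ j, G (β j) = B.F j) (hl : ∀ k, G (lbl e α β k) = C.F k) :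
    Tree.castE (congrArg M.std H.f) (C.T.1.relabel (G := fun k => M.std (G k)) (lbl e α β)
        (fun k => congrArg M.std (hl k))) =
      A.T.1.subst (Tree.pick (G := fun k => M.std (G k)) (fun i => M.std (A.F i)) p
        (fun i _ => α i) (fun i _ => congrArg M.std (hα i))
        (Tree.castE (congrArg M.std h) (B.T.1.relabel (G := fun k => M.std (G k)) β
          fun j => congrArg M.std (hβ j)))) := by
  rw [← Tree.subst_eq_relabel, H.subst]
  congr 1
  funext i
  by_cases hi : i = p
  · subst hi
    rw [Tree.pick_self, dif_pos rfl, ← Tree.subst_eq_relabel]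
    congr 2
    funext j
    rw [Tree.castE_corolla]
    simp only [lbl_inr]
  · rw [Tree.pick_ne _ _ _ _ _ hi, dif_neg hi, Tree.castE_corolla]
    simp only [lbl_inl]

end IsComp

theorem isComp_comp (A B : PlusArr τ) (p : Fin A.n) (h : B.f = A.F p) :
    IsComp A B p h (comp A B p h) (amalg A B p h) where
  f := rfl
  inl i := congrArg (compF A B p) ((amalg A B p h).symm_apply_apply (.inl i))
  inr j := congrArg (compF A B p) ((amalg A B p h).symm_apply_apply (.inr j))
  T := by
    refine (ofTree_T _ _ _ _ _ _).trans ?_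
    refine (Tree.relabel_subst _ _ _ _).trans ?_
    congr 1
    funext i
    by_cases hi : i = p
    · subst hi
      rw [compPick, Tree.pick_self, Tree.pick_self, Tree.relabel_castE]
      refine congrArg _ (Tree.relabel_relabel _ _ _ _ _)
    · rw [compPick, Tree.pick_ne _ _ _ _ _ hi, Tree.pick_ne _ _ _ _ _ hi]
      exact Tree.relabel_corolla _ _ _

variable (τ) in
/-- The one-node tree labelled `f`. -/
noncomputable def one (f : M.Arr) : PlusArr τ where
  n := 1
  F _ := f
  f := f
  T := ⟨Tree.corolla 0 (M.std f) rfl, by simp [Tree.corolla, Tree.nodes],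
    Tree.eval_corolla _ _ _⟩
  ord := by
    obtain ⟨e, he, -⟩ := τ.existsUnique (F := fun _ : Fin 1 => f) (f := f)
      ⟨Tree.corolla 0 (M.std f) rfl, by simp [Tree.corolla, Tree.nodes], Tree.eval_corolla _ _ _⟩
    obtain rfl : e = Equiv.refl _ := Subsingleton.elim _ _
    exact he

theorem isOne_one (f : M.Arr) : IsOne f (one τ f) where
  f := rfl
  n := rfl
  F _ := rfl
  T i := by
    obtain rfl : i = (0 : Fin 1) := Subsingleton.elim (α := Fin 1) _ _
    rfl

theorem one_comp_aux {O A D : PlusArr τ} {g : M.Arr} {p : Fin O.n} {h : A.f = O.F p}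
    {e : {i : Fin O.n // i ≠ p} ⊕ Fin A.n ≃ Fin D.n} (hO : IsOne g O) (H : IsComp O A p h D e) :
    D = A ∧ ∀ j, (e (.inr j) : ℕ) = j := by
  have hG : ∀ i, Sum.elim O.F A.F (Sum.inl i) = O.F i := fun _ => rfl
  have hG' : ∀ i, Sum.elim O.F A.F (Sum.inr i) = A.F i := fun _ => rfl
  have hl := H.lbl_F (Sum.elim O.F A.F) (α := Sum.inl) (β := Sum.inr) hG hG'
  have hf : A.f = g := h.trans (hO.F p)
  have key := unique (A := D) (B := A) (Sum.elim O.F A.F) (lbl e Sum.inl Sum.inr) Sum.inr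
    hl hG' (lbl_injective e Sum.inl_injective Sum.inr_injective fun _ _ => Sum.inl_ne_inr)
    Sum.inr_injective (H.f.trans (hO.f.trans hf.symm)) ?_
  · exact ⟨key.1, fun j => key.2 _ _ (by simp)⟩
  · have h1 := H.relabel _ _ _ hG hG' hl
    have h2 := congrArg (Tree.castE (congrArg M.std (hO.f.trans hf.symm))) h1
    rw [Tree.castE_castE] at h2
    refine h2.trans ?_
    have h3 := hO.T p
    have h4 := congrArg (Tree.castE (congrArg M.std hf.symm)) h3
    rw [Tree.castE_castE] at h4
    rw [← Tree.subst_castE, h4, Tree.castE_corolla, Tree.subst_corolla', Tree.pick_self,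
      Tree.castE_castE, Tree.castE_rfl]

theorem comp_one_aux {O A D : PlusArr τ} {g : M.Arr} {p : Fin A.n} {h : O.f = A.F p}
    {e : {i : Fin A.n // i ≠ p} ⊕ Fin O.n ≃ Fin D.n} (hO : IsOne g O) (H : IsComp A O p h D e) :
    D = A ∧ (∀ i, (e (.inl i) : ℕ) = i.1) ∧ ∀ j, (e (.inr j) : ℕ) = p := by
  have hn : Subsingleton (Fin O.n) := by rw [hO.n]; infer_instance
  let z : Fin O.n := ⟨0, by rw [hO.n]; exact Nat.one_pos⟩
  let θ : Fin A.n → Fin A.n ⊕ Fin O.n := fun i => if i = p then .inr z else .inl i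
  have θp : θ p = .inr z := if_pos rfl
  have θn : ∀ i, i ≠ p → θ i = .inl i := fun i hi => if_neg hi
  clear_value θ
  have iθ : Function.Injective θ := by
    intro i j hij
    by_cases hi : i = p <;> by_cases hj : j = p <;> simp_all
  have hG : ∀ i, Sum.elim A.F O.F (Sum.inl i) = A.F i := fun _ => rfl
  have hG' : ∀ i, Sum.elim A.F O.F (Sum.inr i) = O.F i := fun _ => rfl
  have hl := H.lbl_F (Sum.elim A.F O.F) (α := Sum.inl) (β := Sum.inr) hG hG'
  have hf : O.F z = A.F p := (hO.F z).trans (hO.f.symm.trans h)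
  have hθ : ∀ i, Sum.elim A.F O.F (θ i) = A.F i := by
    intro i
    by_cases hi : i = p
    · subst hi
      rw [θp, hG', hf]
    · rw [θn i hi, hG]
  have key := unique (A := D) (B := A) (Sum.elim A.F O.F) (lbl e Sum.inl Sum.inr) θ
    hl hθ (lbl_injective e Sum.inl_injective Sum.inr_injective fun _ _ => Sum.inl_ne_inr)
    iθ H.f ?_
  · refine ⟨key.1, fun i => key.2 _ _ ?_, fun j => key.2 _ _ ?_⟩
    · rw [lbl_inl, θn _ i.2]
    · rw [lbl_inr, θp, Subsingleton.elim j z]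
  · refine (H.relabel _ _ _ hG hG' hl).trans ?_
    rw [← Tree.subst_eq_relabel θ]
    congr 1
    funext i
    by_cases hi : i = p
    · subst hi
      have h1 := hO.T z
      have h2 : O.T.1 = Tree.corolla (F := fun i => M.std (O.F i)) z (M.std O.f)
          (congrArg M.std ((hO.F z).trans hO.f.symm)) := by
        have h3 := congrArg (Tree.castE (congrArg M.std hO.f.symm)) h1
        rwa [Tree.castE_castE, Tree.castE_rfl, Tree.castE_corolla] at h3
      rw [Tree.pick_self, ← Tree.subst_eq_relabel, h2, Tree.subst_corolla', Tree.castE_castE,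
        Tree.castE_corolla]
      simp only [θp]
    · rw [Tree.pick_ne _ _ _ _ _ hi]
      simp only [θn i hi]

section
variable (A B C : PlusArr τ)

/-- Labels for the nodes of three trees. -/
def F₃ : Fin A.n ⊕ (Fin B.n ⊕ Fin C.n) → M.Arr := Sum.elim A.F (Sum.elim B.F C.F)

theorem F₃_1 (i : Fin A.n) : F₃ A B C (.inl i) = A.F i := rfl

theorem F₃_2 (i : Fin B.n) : F₃ A B C ((Sum.inr ∘ Sum.inl) i) = B.F i := rfl

theorem F₃_3 (i : Fin C.n) : F₃ A B C ((Sum.inr ∘ Sum.inr) i) = C.F i := rfl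

end

theorem assoc_aux {A B C D E X Y : PlusArr τ} {p : Fin A.n} {q : Fin B.n} {h₁ : B.f = A.F p}
    {h₂ : C.f = B.F q} {e : {i : Fin A.n // i ≠ p} ⊕ Fin B.n ≃ Fin D.n}
    {e' : {i : Fin B.n // i ≠ q} ⊕ Fin C.n ≃ Fin E.n}
    {h₃ : C.f = D.F (e (.inr q))} {h₄ : E.f = A.F p}
    {r : {i : Fin D.n // i ≠ e (.inr q)} ⊕ Fin C.n ≃ Fin X.n}
    {s : {i : Fin A.n // i ≠ p} ⊕ Fin E.n ≃ Fin Y.n}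
    (HD : IsComp A B p h₁ D e) (HE : IsComp B C q h₂ E e')
    (HX : IsComp D C (e (.inr q)) h₃ X r) (HY : IsComp A E p h₄ Y s) :
    X = Y ∧ ∀ i j, lbl r (lbl e (K := Fin A.n ⊕ (Fin B.n ⊕ Fin C.n))
        Sum.inl (Sum.inr ∘ Sum.inl)) (Sum.inr ∘ Sum.inr) i =
      lbl s Sum.inl (lbl e' (Sum.inr ∘ Sum.inl) (Sum.inr ∘ Sum.inr)) j → (i : ℕ) = j := by
  have lD := HD.lbl_F (F₃ A B C) (F₃_1 A B C) (F₃_2 A B C)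
  have lE := HE.lbl_F (F₃ A B C) (F₃_2 A B C) (F₃_3 A B C)
  have lX := HX.lbl_F (F₃ A B C) lD (F₃_3 A B C)
  have lY := HY.lbl_F (F₃ A B C) (F₃_1 A B C) lE
  have i₁ : Function.Injective (Sum.inl : Fin A.n → Fin A.n ⊕ (Fin B.n ⊕ Fin C.n)) :=
    Sum.inl_injective
  have i₂ : Function.Injective (Sum.inr ∘ Sum.inl : Fin B.n → Fin A.n ⊕ (Fin B.n ⊕ Fin C.n)) :=
    Sum.inr_injective.comp Sum.inl_injective
  have i₃ : Function.Injective (Sum.inr ∘ Sum.inr : Fin C.n → Fin A.n ⊕ (Fin B.n ⊕ Fin C.n)) :=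
    Sum.inr_injective.comp Sum.inr_injective
  refine unique (F₃ A B C) _ _ lX lY
    (lbl_injective r (lbl_injective e i₁ i₂ (by simp)) i₃ ?_)
    (lbl_injective s i₁ (lbl_injective e' i₂ i₃ (by simp)) ?_)
    (HX.f.trans (HD.f.trans HY.f.symm)) ?_
  · intro k j
    obtain ⟨k | k, rfl⟩ := e.surjective k <;> simp
  · intro i k
    obtain ⟨k | k, rfl⟩ := e'.surjective k <;> simp
  · have h5 := congrArg (Tree.castE (congrArg M.std HD.f)) (HX.relabel _ _ _ lD (F₃_3 A B C) lX)
    have h6 := HY.relabel _ _ _ (F₃_1 A B C) lE lY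
    have h7 := HE.relabel _ _ _ (F₃_2 A B C) (F₃_3 A B C) lE
    rw [Tree.castE_castE, HD.subst] at h5
    refine Tree.castE_shift _ _ (h5.trans (Eq.trans ?_ h6.symm))
    congr 1
    funext i
    by_cases hi : i = p
    · subst hi
      rw [Tree.pick_self, dif_pos rfl, Tree.castE_split _ (congrArg M.std HE.f), h7]
      congr 2
      funext j
      by_cases hj : j = q
      · subst hj
        rw [Tree.pick_self, Tree.pick_self, Tree.castE_castE]
      · rw [Tree.pick_ne _ _ _ _ _ hj, Tree.pick_ne _ _ _ _ _ (by simpa using hj),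
          Tree.castE_corolla]
        simp only [lbl_inr]
    · rw [Tree.pick_ne _ _ _ _ _ hi, dif_neg hi, Tree.pick_ne _ _ _ _ _ (by simp),
        Tree.castE_corolla]
      simp only [lbl_inl]

theorem comm_aux {A B C D E X Y : PlusArr τ} {p q : Fin A.n} {hpq : p ≠ q} {hqp : q ≠ p}
    {h₁ : B.f = A.F p} {h₂ : C.f = A.F q}
    {e : {i : Fin A.n // i ≠ p} ⊕ Fin B.n ≃ Fin D.n}
    {e' : {i : Fin A.n // i ≠ q} ⊕ Fin C.n ≃ Fin E.n}
    {h₃ : C.f = D.F (e (.inl ⟨q, hqp⟩))} {h₄ : B.f = E.F (e' (.inl ⟨p, hpq⟩))}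
    {r : {i : Fin D.n // i ≠ e (.inl ⟨q, hqp⟩)} ⊕ Fin C.n ≃ Fin X.n}
    {s : {i : Fin E.n // i ≠ e' (.inl ⟨p, hpq⟩)} ⊕ Fin B.n ≃ Fin Y.n}
    (HD : IsComp A B p h₁ D e) (HE : IsComp A C q h₂ E e')
    (HX : IsComp D C (e (.inl ⟨q, hqp⟩)) h₃ X r) (HY : IsComp E B (e' (.inl ⟨p, hpq⟩)) h₄ Y s) :
    X = Y ∧ ∀ i j, lbl r (lbl e (K := Fin A.n ⊕ (Fin B.n ⊕ Fin C.n))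
        Sum.inl (Sum.inr ∘ Sum.inl)) (Sum.inr ∘ Sum.inr) i =
      lbl s (lbl e' Sum.inl (Sum.inr ∘ Sum.inr)) (Sum.inr ∘ Sum.inl) j → (i : ℕ) = j := by
  have lD := HD.lbl_F (F₃ A B C) (F₃_1 A B C) (F₃_2 A B C)
  have lE := HE.lbl_F (F₃ A B C) (F₃_1 A B C) (F₃_3 A B C)
  have lX := HX.lbl_F (F₃ A B C) lD (F₃_3 A B C)
  have lY := HY.lbl_F (F₃ A B C) lE (F₃_2 A B C)
  have i₁ : Function.Injective (Sum.inl : Fin A.n → Fin A.n ⊕ (Fin B.n ⊕ Fin C.n)) :=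
    Sum.inl_injective
  have i₂ : Function.Injective (Sum.inr ∘ Sum.inl : Fin B.n → Fin A.n ⊕ (Fin B.n ⊕ Fin C.n)) :=
    Sum.inr_injective.comp Sum.inl_injective
  have i₃ : Function.Injective (Sum.inr ∘ Sum.inr : Fin C.n → Fin A.n ⊕ (Fin B.n ⊕ Fin C.n)) :=
    Sum.inr_injective.comp Sum.inr_injective
  refine unique (F₃ A B C) _ _ lX lY
    (lbl_injective r (lbl_injective e i₁ i₂ (by simp)) i₃ ?_)
    (lbl_injective s (lbl_injective e' i₁ i₃ (by simp)) i₂ ?_)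
    ((HX.f.trans HD.f).trans (HY.f.trans HE.f).symm) ?_
  · intro k j
    obtain ⟨k | k, rfl⟩ := e.surjective k <;> simp
  · intro k j
    obtain ⟨k | k, rfl⟩ := e'.surjective k <;> simp
  · have h5 := congrArg (Tree.castE (congrArg M.std HD.f)) (HX.relabel _ _ _ lD (F₃_3 A B C) lX)
    have h6 := congrArg (Tree.castE (congrArg M.std HE.f)) (HY.relabel _ _ _ lE (F₃_2 A B C) lY)
    rw [Tree.castE_castE, HD.subst] at h5
    rw [Tree.castE_castE, HE.subst] at h6
    refine Tree.castE_shift _ _ (h5.trans (Eq.trans ?_ h6.symm))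
    congr 1
    funext i
    by_cases hi : i = p
    · subst hi
      rw [dif_pos rfl, dif_neg hpq, Tree.pick_self, Tree.castE_castE, ← Tree.subst_eq_relabel (Sum.inr ∘ Sum.inl)]
      congr 2
      funext j
      rw [Tree.pick_ne _ _ _ _ _ (by simp), Tree.castE_corolla]
      simp only [lbl_inr]
    · by_cases hi' : i = q
      · subst hi'
        rw [dif_pos rfl, dif_neg hi, Tree.pick_self, Tree.castE_castE, ← Tree.subst_eq_relabel (Sum.inr ∘ Sum.inr)]
        congr 2
        funext j
        rw [Tree.pick_ne _ _ _ _ _ (by simp), Tree.castE_corolla]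
        simp only [lbl_inr]
      · rw [dif_neg hi, dif_neg hi', Tree.pick_ne _ _ _ _ _ (by simpa using hi'),
          Tree.pick_ne _ _ _ _ _ (by simpa using hi), Tree.castE_corolla, Tree.castE_corolla]
        simp only [lbl_inl]

end PlusArr

open PlusArr in
variable (M τ) in
/-- The slice `M₊`.  Its objects are the arrows of `M`, its arrows are the trees `T` of arrows of `M`,
with source the list of node labels in the order `τ_T` and target the composite of `T`.  Composition
is substitution of trees for nodes, and the amalgamating maps follow the nodes through it. -/
noncomputable def plus : GenMulticat.{w, max u w} where
  Obj := M.Arr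
  Arr := PlusArr τ
  arity A := A.n
  src A := A.F
  tgt A := A.f
  comp A B p h := PlusArr.comp A B p h
  amalg A B p h := PlusArr.amalg A B p h
  one f := PlusArr.one τ f
  tgt_comp _ _ _ _ := rfl
  src_comp_inl A B p h i := (isComp_comp A B p h).inl i
  src_comp_inr A B p h j := (isComp_comp A B p h).inr j
  arity_one _ := rfl
  src_one _ _ := rfl
  tgt_one _ := rfl
  one_comp A f p h := (one_comp_aux (isOne_one f) (isComp_comp (PlusArr.one τ f) A p h)).1
  amalg_one_comp A f p h j := (one_comp_aux (isOne_one f) (isComp_comp (PlusArr.one τ f) A p h)).2 j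
  comp_one A f p h := (comp_one_aux (isOne_one f) (isComp_comp A (PlusArr.one τ f) p h)).1
  amalg_comp_one_inl A f p h := (comp_one_aux (isOne_one f) (isComp_comp A (PlusArr.one τ f) p h)).2.1
  amalg_comp_one_inr A f p h := (comp_one_aux (isOne_one f) (isComp_comp A (PlusArr.one τ f) p h)).2.2
  assoc A B C p q h₁ h₂ h₃ h₄ := (assoc_aux (isComp_comp A B p h₁) (isComp_comp B C q h₂)
    (isComp_comp _ C _ h₃) (isComp_comp A _ p h₄)).1
  amalg_assoc_left A B C p q h₁ h₂ h₃ h₄ i hi hi' :=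
    (assoc_aux (isComp_comp A B p h₁) (isComp_comp B C q h₂)
      (isComp_comp _ C _ h₃) (isComp_comp A _ p h₄)).2 _ _ (by
        rw [lbl_inl, lbl_inl, lbl_inl])
  amalg_assoc_middle A B C p q h₁ h₂ h₃ h₄ j hj hj' :=
    (assoc_aux (isComp_comp A B p h₁) (isComp_comp B C q h₂)
      (isComp_comp _ C _ h₃) (isComp_comp A _ p h₄)).2 _ _ (by
        rw [lbl_inl, lbl_inr, lbl_inr, lbl_inl])
  amalg_assoc_right A B C p q h₁ h₂ h₃ h₄ l :=
    (assoc_aux (isComp_comp A B p h₁) (isComp_comp B C q h₂)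
      (isComp_comp _ C _ h₃) (isComp_comp A _ p h₄)).2 _ _ (by
        rw [lbl_inr, lbl_inr, lbl_inr])
  comm A B C p q hpq hqp h₁ h₂ h₃ h₄ :=
    (comm_aux (isComp_comp A B p h₁) (isComp_comp A C q h₂)
      (isComp_comp _ C _ h₃) (isComp_comp _ B _ h₄)).1
  amalg_comm_left A B C p q hpq hqp h₁ h₂ h₃ h₄ i hp hq hp' hq' :=
    (comm_aux (isComp_comp A B p h₁) (isComp_comp A C q h₂)
      (isComp_comp _ C _ h₃) (isComp_comp _ B _ h₄)).2 _ _ (by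
        rw [lbl_inl, lbl_inl, lbl_inl, lbl_inl])
  amalg_comm_middle A B C p q hpq hqp h₁ h₂ h₃ h₄ j hj :=
    (comm_aux (isComp_comp A B p h₁) (isComp_comp A C q h₂)
      (isComp_comp _ C _ h₃) (isComp_comp _ B _ h₄)).2 _ _ (by
        rw [lbl_inl, lbl_inr, lbl_inr])
  amalg_comm_right A B C p q hpq hqp h₁ h₂ h₃ h₄ l hl :=
    (comm_aux (isComp_comp A B p h₁) (isComp_comp A C q h₂)
      (isComp_comp _ C _ h₃) (isComp_comp _ B _ h₄)).2 _ _ (by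
        rw [lbl_inr, lbl_inl, lbl_inr])

end GenMulticat


/-! ### The planar choice of node numberings -/

namespace SymMulticat.Tree

variable {Q : SymMulticat.{u, v, w}} {I J : Type} {F : I → Elt Q} {G : J → Elt Q}
  {L : Type} {x : L → Q.Obj}

/-- The numbers of the nodes, listed depth first from left to right. -/
def nodeList {d : Q.Obj} : Tree Q F x d → List I
  | leaf _ _ => []
  | node i _ _ _ ch => i :: (List.ofFn fun j => (ch j).nodeList).flatten

theorem coe_nodeList {d : Q.Obj} (T : Tree Q F x d) : (T.nodeList : Multiset I) = T.nodes := by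
  induction T with
  | leaf => rfl
  | node i g h b ch ih =>
    simp only [nodeList, nodes, ← Multiset.cons_coe, ← Multiset.coe_join, ← ih]
    congr 1
    rw [Multiset.join, Multiset.sum_coe, List.map_ofFn, List.sum_ofFn]
    rfl

theorem nodeList_relabel (φ : I → J) (hφ : ∀ i, G (φ i) = F i) {d : Q.Obj} (T : Tree Q F x d) :
    (T.relabel φ hφ).nodeList = T.nodeList.map φ := by
  induction T with
  | leaf => rfl
  | node i g h b ch ih =>
    simp only [nodeList, relabel, ih, List.map_cons, List.map_flatten, List.map_ofFn]
    rfl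

end SymMulticat.Tree

namespace GenMulticat

variable (M : GenMulticat.{u, w})

/-- Number the nodes of every tree depth first from left to right. -/
def NodeOrder.planar : NodeOrder M where
  Ordered {n _ _} T := T.1.nodeList = List.finRange n
  existsUnique {n F f} T := by
    have h1 : ∀ e : Equiv.Perm (Fin n),
        (SymMulticat.SliceArr.act (F' := fun i => M.std (F (e i))) e (fun _ => rfl) T).1.nodeList =
          List.finRange n ↔ List.ofFn e = T.1.nodeList := by
      intro e
      have h2 : (SymMulticat.SliceArr.act (F' := fun i => M.std (F (e i))) e
          (fun _ => rfl) T).1.nodeList = T.1.nodeList.map e.symm :=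
        SymMulticat.Tree.nodeList_relabel _ _ _
      rw [h2, List.ofFn_eq_map, ← (List.map_injective_iff.2 e.injective).eq_iff, List.map_map,
        Equiv.self_comp_symm, List.map_id, eq_comm]
    have h3 : (T.1.nodeList : Multiset (Fin n)) = Finset.univ.val :=
      (SymMulticat.Tree.coe_nodeList _).trans T.2.1
    have h4 : T.1.nodeList.length = n := by
      simpa using congrArg Multiset.card h3
    have h5 : T.1.nodeList.Nodup := Multiset.coe_nodup.1 (by rw [h3]; exact Finset.univ.nodup)
    have h6 : ∃ g : Fin n → Fin n, List.ofFn g = T.1.nodeList :=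
      ⟨fun i => T.1.nodeList.get (i.cast h4.symm), by
        rw [List.ofFn_congr h4.symm]
        exact List.ofFn_get _⟩
    obtain ⟨g, hg⟩ := h6
    rw [← hg, List.nodup_ofFn] at h5
    refine ⟨Equiv.ofBijective g (Finite.injective_iff_bijective.1 h5), (h1 _).2 hg, ?_⟩
    intro e he
    apply Equiv.ext
    intro i
    exact congrFun (List.ofFn_injective (((h1 e).1 he).trans hg.symm)) i

end GenMulticat

/-! The object-morphisms of `ξ(M)` are identities, so the edge labels of its trees carry no
information. The two sides therefore differ only in permutations: in `ξ(M)⁺` the nodes are labelled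
by pairs `(f, σ)` and numbered arbitrarily, whereas in `ξ(M₊)` they are labelled by arrows `f` of
`M`, and an arrow is a tree numbered by `τ` together with a permutation.

Objects. A morphism `(f, σ) ⟶ (f', σ')` of elements forces `f = f'`, because composing with units
does not change the underlying arrow of `M`. Its permutation is forced too, because it has to match
the inputs of this common arrow (`σ_inputs`). So there is exactly one morphism if `f = f'` and none
otherwise, and `(f, σ) ↦ f` is an equivalence onto the discrete category on the arrows of `M`. In
particular every element `g` has an isomorphism `stdIso g` from the element with the same underlying
arrow and trivial permutation.

Arrows. The bijection on arrows is a composite of two. Conjugation with the isomorphisms `stdIso`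
makes all labels standard, the permutations being absorbed by the order of the subtrees and the
numbering of the leaves (`SliceArr.conjEquiv`). It respects composition because `stdIso` and its
inverse meet at every node that is substituted for, and cancel (`SliceArr.push_pull_comp`). Next, a
tree with standard labels and numbered nodes amounts to a tree numbered by `τ` with a permutation,
since exactly one renumbering is the chosen one (`configEquiv`). The inverse of this second
bijection is `labTree`, which numbers each node by its label and so forgets `τ`.

Since `labTree` is injective on bijectively labelled arrows, the laws of a morphism can be checked
on trees. The essential point is `labTree_bind`: composition in `ξ(M₊)`, defined by composing in one
input after another, becomes simultaneous substitution of trees, because the final result of the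
substitution is invariant under every single step. As `τ` does not occur in the resulting formulas,
every choice of numberings will do. -/

/-! ### Transporting trees along morphisms of elements -/

namespace SymMulticat

variable {Q : SymMulticat.{u, v, w}}

namespace Tree

variable {I J H : Type} {F F' F'' : I → Elt Q} {G : J → Elt Q} {L : Type} {x : L → Q.Obj}
  {d : Q.Obj}

/-- Compose the root edge and the leaf edges of a tree with the components of a morphism, and
renumber the leaves according to its permutation. -/
def push {g g' : Elt Q} (β : g ⟶ g') (U : Tree Q F g.src g.tgt) : Tree Q F g'.src g'.tgt :=
  post (Elt.Hom.b β) (graft (fun j => leaf (Elt.Hom.σ β j) (Elt.Hom.a β j)) U)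

@[simp] theorem push_id {g : Elt Q} (U : Tree Q F g.src g.tgt) : push (𝟙 g) U = U := by
  change post (𝟙 _) (graft (fun j => leaf j (𝟙 _)) U) = U
  rw [graft_leaf, post_id]

@[simp] theorem push_push {g g' g'' : Elt Q} (β : g ⟶ g') (γ : g' ⟶ g'')
    (U : Tree Q F g.src g.tgt) : push γ (push β U) = push (β ≫ γ) U := by
  simp only [push, graft_post, graft_graft, post_post]
  rfl

@[simp] theorem push_subst {g g' : Elt Q} (β : g ⟶ g') (U : Tree Q F g.src g.tgt)
    (S : ∀ i, Tree Q G (F i).src (F i).tgt) : (push β U).subst S = push β (U.subst S) := by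
  simp only [push, subst_post, subst_graft, subst]

@[simp] theorem relabel_push {g g' : Elt Q} (β : g ⟶ g') (U : Tree Q F g.src g.tgt)
    (φ : I → J) (hφ : ∀ i, G (φ i) = F i) :
    (push β U).relabel φ hφ = push β (U.relabel φ hφ) := by
  simp only [push, relabel_post, relabel_graft, relabel]

/-- Between elements with at most one morphism, any morphism that connects equal elements is an
`eqToHom`; pushing along it is then mere transport. -/
theorem push_eqToHom {g g' : Elt Q} (e : g = g') (U : Tree Q F g.src g.tgt) :
    push (eqToHom e) U = castE e U := by
  subst e
  exact push_id U

/-- The right-hand side is the one-node tree which represents `β` in the slice, so `ι` of the slice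
is expressed through `push`. -/
theorem push_corolla {g' : Elt Q} (i : I) (β : F i ⟶ g') :
    push β (corolla i (F i) rfl) =
      node i (F i) rfl (Elt.Hom.b β) fun j => leaf (Elt.Hom.σ β j) (Elt.Hom.a β j) := by
  simp [push, corolla, graft]

/-- By definition, pushing `U` along `β` substitutes `U` for the only node of the tree of `β`. The
composite is therefore that of the latter tree, which is the target of `β` by the defining equation
of a morphism of elements. -/
theorem eval_push {g g' : Elt Q} (β : g ⟶ g') {U : Tree Q F g.src g.tgt}
    (h : LArr.Rel U.eval (LArr.of g.arr)) : LArr.Rel (push β U).eval (LArr.of g'.arr) :=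
  (eval_subst (fun _ => U) (fun _ => h) (Elt.Hom.tree β)).trans (Elt.Hom.eval_tree β)

@[simp] theorem nodes_push {g g' : Elt Q} (β : g ⟶ g') (U : Tree Q F g.src g.tgt) :
    (push β U).nodes = U.nodes := by
  simp [push, nodes_graft, nodes]

/-! ### Pulling node labels back along morphisms of elements -/

/-- Replace the node labels of a tree along morphisms `α i : F' i ⟶ F i`. -/
def pull (α : ∀ i, F' i ⟶ F i) (T : Tree Q F x d) : Tree Q F' x d :=
  T.subst fun i => push (α i) (corolla i (F' i) rfl)

/-- Pushing commutes with substitution, so the morphism at a node can be moved onto the tree that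
replaces the node. This is what lets the isomorphisms inside a composite meet and cancel. -/
theorem pull_subst (α : ∀ i, F' i ⟶ F i) (T : Tree Q F x d)
    (S : ∀ i, Tree Q G (F' i).src (F' i).tgt) :
    (T.pull α).subst S = T.subst fun i => push (α i) (S i) := by
  rw [pull, subst_subst]
  simp only [push_subst, subst_corolla]

theorem pull_pull (α : ∀ i, F' i ⟶ F i) (α' : ∀ i, F'' i ⟶ F' i) (T : Tree Q F x d) :
    (T.pull α).pull α' = T.pull fun i => α' i ≫ α i := by
  rw [pull, pull_subst]
  simp only [push_push, pull]

/-- Substituting corollas is a renumbering of the nodes, here the trivial one. -/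
theorem pull_id (T : Tree Q F x d) : T.pull (fun i => 𝟙 (F i)) = T := by
  simp only [pull, push_id]
  rw [subst_eq_relabel (fun i => i) (fun _ => rfl)]
  exact relabel_id _ _ (fun _ => rfl) T

theorem pull_push {g g' : Elt Q} (β : g ⟶ g') (α : ∀ i, F' i ⟶ F i) (U : Tree Q F g.src g.tgt) :
    (push β U).pull α = push β (U.pull α) :=
  push_subst _ _ _

theorem eval_push_corolla {g : Elt Q} (i : I) (α : F i ⟶ g) :
    LArr.Rel (push α (corolla i (F i) rfl)).eval (LArr.of g.arr) :=
  eval_push α (eval_corolla _ _ _)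

theorem eval_pull (α : ∀ i, F' i ⟶ F i) (T : Tree Q F x d) :
    LArr.Rel (T.pull α).eval T.eval :=
  eval_subst _ (fun i => eval_push_corolla i (α i)) T

/-- Counting nodes after a substitution requires every input of a replaced node to occur exactly
once among the leaves of its replacement; this follows from the composite of the replacement. -/
theorem nodes_pull (α : ∀ i, F' i ⟶ F i) (T : Tree Q F x d) : (T.pull α).nodes = T.nodes := by
  rw [pull, nodes_subst _ fun i => leaves_of_eval (eval_push_corolla i (α i))]
  simp [corolla, nodes]

theorem castE_apply {A : Type} (X : A → Elt Q) (P : ∀ a, Tree Q F (X a).src (X a).tgt)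
    {g : Elt Q} {a b : A} (hab : a = b) (e : X a = g) (e' : X b = g) :
    castE e (P a) = castE e' (P b) := by
  subst hab
  rfl

/-- Renumbering gives only propositional equalities between labels. Since the family `s` depends on
nothing but the label, it is compatible with transport along them. -/
theorem castE_push_corolla {X : Elt Q → Elt Q} (s : ∀ g, X g ⟶ g) {g g' : Elt Q} (e : g = g')
    (j : J) (h : G j = X g) (h' : G j = X g') :
    castE e (push (s g) (corolla j (X g) h)) = push (s g') (corolla j (X g') h') := by
  subst e
  rfl

/-- The morphism used at a node depends on the label of the node and not on its number, so it does
not matter whether the nodes are renumbered before or after pulling back. -/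
theorem relabel_pull {X : Elt Q → Elt Q} (s : ∀ g, X g ⟶ g) (φ : I → J)
    (hφ : ∀ i, G (φ i) = F i) (hφ' : ∀ i, X (G (φ i)) = X (F i)) (T : Tree Q F x d) :
    (T.pull fun i => s (F i)).relabel (G := fun j => X (G j)) φ hφ' =
      (T.relabel φ hφ).pull fun j => s (G j) := by
  rw [pull, relabel_subst, pull, subst_relabel']
  congr 1
  funext i
  rw [relabel_push, relabel_corolla (F := fun i => X (F i)) (G := fun j => X (G j))]
  exact (castE_push_corolla s (hφ i) _ _ _).symm

end Tree

/-! ### Conjugating arrows of the slice by isomorphisms of elements -/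

namespace SliceArr

/-- Replace the labels of a tree along morphisms `α i : F' i ⟶ F i`, and its composite along
`β : f ⟶ f'`. -/
def conj {n : ℕ} {F F' : Fin n → Elt Q} {f f' : Elt Q} (α : ∀ i, F' i ⟶ F i) (β : f ⟶ f')
    (T : SliceArr Q F f) : SliceArr Q F' f' :=
  ⟨Tree.push β (T.1.pull α), by rw [Tree.nodes_push, Tree.nodes_pull, T.2.1],
    Tree.eval_push β ((Tree.eval_pull α T.1).trans T.2.2)⟩

theorem conj_conj {n : ℕ} {F F' F'' : Fin n → Elt Q} {f f' f'' : Elt Q} (α : ∀ i, F' i ⟶ F i)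
    (β : f ⟶ f') (α' : ∀ i, F'' i ⟶ F' i) (β' : f' ⟶ f'') (T : SliceArr Q F f) :
    conj α' β' (conj α β T) = conj (fun i => α' i ≫ α i) (β ≫ β') T :=
  Subtype.ext (by
    dsimp only [conj]
    rw [Tree.pull_push, Tree.push_push, Tree.pull_pull])

theorem conj_id {n : ℕ} {F : Fin n → Elt Q} {f : Elt Q} (T : SliceArr Q F f) :
    conj (fun i => 𝟙 (F i)) (𝟙 f) T = T :=
  Subtype.ext (by
    dsimp only [conj]
    rw [Tree.pull_id, Tree.push_id])

/-- `conj` along isomorphisms is a bijection. -/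
def conjEquiv {n : ℕ} {F F' : Fin n → Elt Q} {f f' : Elt Q} (α : ∀ i, F' i ≅ F i) (β : f' ≅ f) :
    SliceArr Q F f ≃ SliceArr Q F' f' where
  toFun := conj (fun i => (α i).hom) β.inv
  invFun := conj (fun i => (α i).inv) β.hom
  left_inv T := by
    rw [conj_conj]
    simp only [Iso.inv_hom_id]
    exact conj_id T
  right_inv T := by
    rw [conj_conj]
    simp only [Iso.hom_inv_id]
    exact conj_id T

theorem push_pull_act {X : Elt Q → Elt Q} (s : ∀ g, X g ≅ g) {n m : ℕ} {F : Fin m → Elt Q}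
    {F' : Fin n → Elt Q} {f : Elt Q} (σ : Fin n ≃ Fin m) (h : ∀ i, F' i = F (σ i))
    (h' : ∀ i, X (F' (σ.symm i)) = X (F i)) (T : SliceArr Q F f) :
    Tree.push (s f).inv ((T.act σ h).1.pull fun i => (s (F' i)).hom) =
      (Tree.push (s f).inv (T.1.pull fun i => (s (F i)).hom)).relabel
        (G := fun i => X (F' i)) σ.symm h' := by
  rw [Tree.relabel_push, Tree.relabel_pull (fun g => (s g).hom) _
    (fun i => by rw [h, Equiv.apply_symm_apply])]
  rfl

/-- On the right the node `i` of `T` contributes `(s (F i)).hom`, while the tree substituted for it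
carries `(s (F i)).inv` at its root and leaves. These cancel, and only the isomorphisms at the inner
labels and at the outer composite remain. -/
theorem push_pull_comp {X : Elt Q → Elt Q} (s : ∀ g, X g ≅ g) {k : ℕ} {F : Fin k → Elt Q}
    {f : Elt Q} {m : Fin k → ℕ} {z : ∀ i, Fin (m i) → Elt Q} (T : SliceArr Q F f)
    (S : ∀ i, SliceArr Q (z i) (F i))
    (h' : ∀ i j, (fun p : Fin (∑ i, m i) => X (z (split p).1 (split p).2)) (split.symm ⟨i, j⟩) =
      X (z i j)) :
    Tree.push (s f).inv ((T.comp S).1.pull fun p => (s (z (split p).1 (split p).2)).hom) =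
      (Tree.push (s f).inv (T.1.pull fun i => (s (F i)).hom)).subst fun i =>
        (Tree.push (s (F i)).inv ((S i).1.pull fun j => (s (z i j)).hom)).relabel
          (G := fun p => X (z (split p).1 (split p).2)) (fun j => split.symm ⟨i, j⟩) (h' i) := by
  rw [Tree.push_subst, Tree.pull_subst]
  -- Both sides are now substitutions into `T`, so they can be compared node by node.
  refine congrArg _ ((Tree.subst_subst _ _ _).trans ?_)
  congr 1
  funext i
  -- The isomorphism from the node of `T` meets the inverse from the substituted tree.
  rw [Tree.relabel_push, Tree.push_push, Iso.inv_hom_id, Tree.push_id]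
  exact (Tree.relabel_pull (fun g => (s g).hom) _ (src_split z i) _ _).symm

end SliceArr

end SymMulticat

/-! ### Labelled arrows of `ξ(M)` -/

namespace GenMulticat

open SymMulticat (Tree SliceArr Elt LArr)

variable {M : GenMulticat.{u, w}}

/-- A labelled arrow of `ξ(M)`, as a labelled arrow of `M`. -/
def toMLab {L : Type} {x : L → M.xi.Obj} {d : M.xi.Obj} (a : LArr M.xi x d) :
    MLab M (fun l => Discrete.as (x l)) (Discrete.as d) :=
  MLab.map a.lab (fun _ => rfl) (Subtype.val a.arr : MLab M (fun i => Discrete.as (x (a.lab i))) _)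

section
variable {L : Type} {x : L → M.xi.Obj} {d : M.xi.Obj}

/-- Composition in `ξ(M)` labels an input by its position in the concatenated list, and the labelled
arrow then replaces positions by labels. Relabelling commutes with `bind`, so this can be done
separately for each `e j`. -/
theorem toMLab_comp {k : ℕ} {y : Fin k → M.xi.Obj} (f : M.xi.Arr y d)
    (e : ∀ j, LArr M.xi x (y j)) :
    toMLab (LArr.comp f e) = MLab.bind (Subtype.val f) fun j => toMLab (e j) := by
  refine (MLab.map_bind _ _ _ _).trans ?_
  congr 1
  funext j
  refine (MLab.map_map _ _ _ _ _).trans ?_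
  refine MLab.map_congr (fun i => ?_) _ _ _
  change (e (split (split.symm (⟨j, i⟩ : Σ j, Fin (e j).n))).1).lab _ = _
  rw [Equiv.apply_symm_apply]

/-- The action of `σ` changes the numbering in `ξ(M)` by `σ⁻¹` and the labels by `σ`; the two
cancel. With the converse below, labelled arrows up to permutation are exactly labelled arrows of
`M`, where equations are strict. -/
theorem toMLab_eq_of_rel {a b : LArr M.xi x d} (h : LArr.Rel a b) : toMLab a = toMLab b := by
  obtain ⟨σ, hl, ha⟩ := h
  symm
  rw [toMLab, ha]
  refine (MLab.map_map (x := fun i => (x (a.lab i)).as) σ.symm (fun i => by simp [hl]) b.lab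
    (fun _ => rfl) (Subtype.val a.arr)).trans ?_
  refine MLab.map_congr (fun i => ?_) _ _ _
  rw [hl, Equiv.apply_symm_apply]

theorem rel_of_toMLab_eq {a b : LArr M.xi x d} (h : toMLab a = toMLab b) : LArr.Rel a b := by
  have h1 : (Subtype.val a.arr).arr = (Subtype.val b.arr).arr := congrArg MLab.arr h
  let ea := Equiv.ofBijective _ (Subtype.property a.arr)
  let eb := Equiv.ofBijective _ (Subtype.property b.arr)
  -- The only possible permutation: go from positions of `b` to inputs of the common arrow of `M`,
  -- and from there to positions of `a`.
  let σ : Fin b.n ≃ Fin a.n := (eb.symm.trans (finCongr (congrArg M.arity h1.symm))).trans ea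
  have key : ∀ i, σ (eb i) = ea (finCongr (congrArg M.arity h1.symm) i) := fun i => by simp [σ]
  refine ⟨σ, fun i => ?_, ?_⟩
  · obtain ⟨i, rfl⟩ := eb.surjective i
    rw [key]
    exact (MLab.lab_congr h (finCongr (congrArg M.arity h1.symm) i) i rfl).symm
  · apply Subtype.ext
    refine MLab.ext' h1.symm fun i j hij => ?_
    change eb i = σ.symm (ea j)
    rw [Equiv.eq_symm_apply, key]
    congr 1
    exact Fin.ext hij

end

/-! ### The category of elements of `ξ(M)` -/

/-- The arrow of `M` underlying an arrow of `ξ(M)`. -/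
def under (g : Elt M.xi) : M.Arr := (Subtype.val g.arr).arr

/-- The inputs of the arrow of `M` underlying an arrow of `ξ(M)`, matched with those of the
latter. -/
noncomputable def inputs (g : Elt M.xi) : Fin (M.arity (under g)) ≃ Fin g.n :=
  Equiv.ofBijective _ (Subtype.property g.arr)

theorem src_under (g : Elt M.xi) (i : Fin (M.arity (under g))) :
    M.src (under g) i = Discrete.as (g.src (inputs g i)) :=
  MLab.src_eq (Subtype.val g.arr) i

theorem tgt_under (g : Elt M.xi) : M.tgt (under g) = Discrete.as g.tgt :=
  MLab.tgt_eq (Subtype.val g.arr)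

/-- Composing with `ι` of identities leaves the underlying arrow of `M` unchanged and only renames
its inputs. The equality of arrows is part of the existential because the second clause transports
positions along it. Bijectivity of `σ` plays no role here. -/
theorem toMLab_hom {g g' : Elt M.xi} (σ : Fin g.n → Fin g'.n)
    (a : ∀ i, g'.src (σ i) ⟶ g.src i) (b : g.tgt ⟶ g'.tgt) :
    ∃ h : (toMLab (LArr.comp (M.xi.ι b) fun _ : Fin 1 =>
        LArr.comp g.arr fun i => LArr.edge (x := g'.src) (σ i) (a i))).arr = under g,
      ∀ i, (toMLab (LArr.comp (M.xi.ι b) fun _ : Fin 1 =>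
        LArr.comp g.arr fun i => LArr.edge (x := g'.src) (σ i) (a i))).lab i =
          σ (inputs g (finCongr (congrArg M.arity h) i)) := by
  obtain ⟨n, src, tgt, arr⟩ := g
  obtain ⟨n', src', tgt', arr'⟩ := g'
  obtain ⟨tgt⟩ := tgt
  obtain ⟨tgt'⟩ := tgt'
  -- In a discrete category `b` amounts to an equality of the targets; after substituting it, `ι(b)`
  -- is a unit.
  obtain rfl : tgt = tgt' := Discrete.eq_of_hom b
  have key : toMLab (LArr.comp (M.xi.ι b) fun _ : Fin 1 =>
      LArr.comp arr fun i => LArr.edge (x := src') (σ i) (a i)) =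
      MLab.map σ (fun i => Discrete.eq_of_hom (a i)) (Subtype.val arr) := by
    -- `pure_bind` removes the unit at the root and `bind_pure` those at the inputs.
    refine (toMLab_comp _ _).trans ((MLab.pure_bind _ _).trans ((toMLab_comp _ _).trans ?_))
    refine Eq.trans ?_ (MLab.bind_pure _)
    symm
    apply MLab.bind_map
    intro i
    -- Each `a i` is an equality of source objects, along which the unit has to be transported.
    have : ∀ {c c' : M.Obj} (e : c = c') (l : Fin n') (h : (src' l).as = c)
        (h' : (src' l).as = c'),
        (MLab.pure l h' : MLab M (fun l => Discrete.as (src' l)) c') = e ▸ MLab.pure l h := by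
      intro c c' e l h h'
      subst e
      rfl
    exact this _ _ _ (Discrete.eq_of_hom (a i))
  refine ⟨congrArg MLab.arr key, fun i => ?_⟩
  exact MLab.lab_congr key i _ rfl

theorem under_eq {g g' : Elt M.xi} (α : g ⟶ g') : under g = under g' :=
  (toMLab_hom _ (Elt.Hom.a α) (Elt.Hom.b α)).1.symm.trans
    (congrArg MLab.arr (toMLab_eq_of_rel (Elt.Hom.eq α)))

/-- The defining equation of `α`, read in `M`, compares two labellings of the inputs of one arrow.
Hence the permutation of `α` is determined by the numberings of `g` and `g'`. -/
theorem σ_inputs {g g' : Elt M.xi} (α : g ⟶ g') (i : Fin (M.arity (under g))) :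
    Elt.Hom.σ α (inputs g i) = inputs g' (finCongr (congrArg M.arity (under_eq α)) i) := by
  obtain ⟨h, hl⟩ := toMLab_hom _ (Elt.Hom.a α) (Elt.Hom.b α)
  have h1 := hl (finCongr (congrArg M.arity h.symm) i)
  exact h1.symm.trans (MLab.lab_congr (toMLab_eq_of_rel (Elt.Hom.eq α)) _ _ rfl)

/-- The permutation is determined by `σ_inputs`, because `inputs g` is surjective; the remaining
components are morphisms of a discrete category. -/
instance (g g' : Elt M.xi) : Subsingleton (g ⟶ g') where
  allEq α β := by
    have hσ : Elt.Hom.σ α = Elt.Hom.σ β := by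
      ext i
      obtain ⟨i, rfl⟩ := (inputs g).surjective i
      rw [σ_inputs, σ_inputs]
    obtain ⟨σ, a, b, h⟩ := α
    obtain ⟨σ', a', b', h'⟩ := β
    obtain rfl : σ = σ' := hσ
    -- Writing the source as `Discrete.mk _` exhibits the hom-set as one of a discrete category,
    -- which has at most one element.
    refine Elt.Hom.ext' rfl (heq_of_eq ?_) (Subsingleton.elim (α := Discrete.mk _ ⟶ _) _ _)
    funext i
    exact Subsingleton.elim (α := Discrete.mk _ ⟶ _) _ _

/-- Arrows of `ξ(M)` with the same underlying arrow of `M` differ by a permutation only. -/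
noncomputable def homOfUnder {g g' : Elt M.xi} (e : under g = under g') : g ⟶ g' :=
  let c := finCongr (congrArg M.arity e)
  -- By `σ_inputs` no other permutation is possible.
  let σ := ((inputs g).symm.trans c).trans (inputs g')
  have hσ : ∀ i, σ (inputs g i) = inputs g' (c i) := fun i => by simp [σ]
  have src_cast : ∀ {f f' : M.Arr} (e : f = f') (i : Fin (M.arity f)),
      M.src f' (finCongr (congrArg M.arity e) i) = M.src f i := by
    intro f f' e i
    subst e
    rfl
  have ha : ∀ i, g'.src (σ i) = g.src i := fun i => by
    obtain ⟨i, rfl⟩ := (inputs g).surjective i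
    apply Discrete.ext
    rw [hσ]
    exact (src_under g' _).symm.trans ((src_cast e i).trans (src_under g i))
  have hb : g.tgt = g'.tgt :=
    Discrete.ext ((tgt_under g).symm.trans ((congrArg M.tgt e).trans (tgt_under g')))
  { σ := σ
    a := fun i => eqToHom (ha i)
    b := eqToHom hb
    eq := by
      -- In `M` both sides have the same underlying arrow, and `σ` was chosen so that the labels of
      -- its inputs agree.
      apply rel_of_toMLab_eq
      obtain ⟨h, hl⟩ := toMLab_hom σ (fun i => eqToHom (ha i)) (eqToHom hb)
      refine MLab.ext' (h.trans e) fun i j hij => ?_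
      refine (hl i).trans ((hσ _).trans ?_)
      change _ = inputs g' j
      congr 1
      exact Fin.ext hij }

/-- Arrows of `ξ(M)` with the same underlying arrow of `M` are isomorphic. -/
noncomputable def isoOfUnder {g g' : Elt M.xi} (e : under g = under g') : g ≅ g' where
  hom := homOfUnder e
  inv := homOfUnder e.symm
  hom_inv_id := Subsingleton.elim _ _
  inv_hom_id := Subsingleton.elim _ _

/-- Every arrow of `ξ(M)` is isomorphic to one with trivial permutation. -/
noncomputable def stdIso (g : Elt M.xi) : M.std (under g) ≅ g := isoOfUnder rfl

variable (τ : NodeOrder M)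

/-- The functor from the objects of `ξ(M)⁺` to those of `ξ(M₊)`. -/
noncomputable def underFunctor : Elt M.xi ⥤ (plus M τ).xi.Obj where
  obj g := Discrete.mk (under g)
  map α := eqToHom (congrArg Discrete.mk (under_eq α))
  map_id _ := Subsingleton.elim (α := Discrete.mk _ ⟶ Discrete.mk _) _ _
  map_comp _ _ := Subsingleton.elim (α := Discrete.mk _ ⟶ Discrete.mk _) _ _

/-- Faithfulness is automatic since hom-sets have at most one element, and fullness is the existence
of a morphism between elements with equal underlying arrows. Every arrow `f` of `M` is the
underlying arrow of its standard element. -/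
theorem isEquivalence_underFunctor : (underFunctor τ).IsEquivalence where
  faithful := ⟨fun _ => Subsingleton.elim _ _⟩
  full := ⟨fun a => ⟨homOfUnder (Discrete.eq_of_hom a),
    Subsingleton.elim (α := Discrete.mk _ ⟶ Discrete.mk _) _ _⟩⟩
  essSurj := ⟨fun f => ⟨M.std (Discrete.as f), ⟨Iso.refl _⟩⟩⟩

end GenMulticat

/-! ### Labelled arrows of `M₊` as trees -/

namespace GenMulticat

open SymMulticat (Tree SliceArr Elt LArr)

variable {M : GenMulticat.{u, w}} {τ : NodeOrder M}

section
variable {K L : Type} {x : K → M.Arr} {y : L → M.Arr} {d : M.Arr}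

namespace PlusArr

/-- The tree of an arrow of `M₊`, its nodes being renumbered by `K`. -/
noncomputable def tree (A : PlusArr τ) (l : Fin A.n → K) (hl : ∀ i, x (l i) = A.F i)
    (hd : A.f = d) : Tree M.xi (fun k => M.std (x k)) (M.std d).src (M.std d).tgt :=
  Tree.castE (congrArg M.std hd)
    (A.T.1.relabel (G := fun k => M.std (x k)) l fun i => congrArg M.std (hl i))

variable (A B : PlusArr τ) (l : Fin A.n → K) (hl : ∀ i, x (l i) = A.F i) (hd : A.f = d)

theorem eval_tree : LArr.Rel (A.tree l hl hd).eval (LArr.of (M.std d).arr) := by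
  apply Tree.castE_eval
  rw [Tree.eval_relabel]
  exact A.T.2.2

theorem nodes_tree : (A.tree l hl hd).nodes = Finset.univ.val.map l := by
  rw [tree, Tree.nodes_castE, Tree.nodes_relabel, A.T.2.1]

theorem tree_relabel (θ : K → L) (hθ : ∀ k, y (θ k) = x k) :
    (A.tree l hl hd).relabel (G := fun k => M.std (y k)) θ (fun k => congrArg M.std (hθ k)) =
      A.tree (fun i => θ (l i)) (fun i => (hθ _).trans (hl i)) hd := by
  rw [tree, tree, Tree.relabel_castE, Tree.relabel_relabel]

theorem tree_subst {J : Type} {G : J → Elt M.xi}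
    (S : ∀ k, Tree M.xi G (M.std (x k)).src (M.std (x k)).tgt) :
    (A.tree l hl hd).subst S = Tree.castE (congrArg M.std hd)
      (A.T.1.subst fun i => Tree.castE (congrArg M.std (hl i)) (S (l i))) := by
  rw [tree, Tree.subst_castE, Tree.subst_relabel']

-- The invariance behind `labTree_bind`. If substituting `S` into `B` yields exactly what `S` puts
-- in place of the node `p` of `A`, then it makes no difference whether `p` is first replaced by
-- `B`.
variable {A B} in
theorem IsComp.tree_subst {p : Fin A.n} {h : B.f = A.F p} {C : PlusArr τ}
    {e : {i : Fin A.n // i ≠ p} ⊕ Fin B.n ≃ Fin C.n} (H : IsComp A B p h C e)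
    (l' : Fin B.n → K) (hl' : ∀ i, x (l' i) = B.F i) (hl₂ : ∀ i, x (lbl e l l' i) = C.F i)
    (hd₂ : C.f = d) {J : Type} {G : J → Elt M.xi}
    (S : ∀ k, Tree M.xi G (M.std (x k)).src (M.std (x k)).tgt)
    (hS : (B.tree l' hl' (h.trans (hl p).symm)).subst S = S (l p)) :
    (C.tree (lbl e l l') hl₂ hd₂).subst S = (A.tree l hl hd).subst S := by
  rw [PlusArr.tree_subst] at hS ⊢
  -- The transport is split at `C.f = A.f`, since `H.subst` computes the tree of `C` only after
  -- transport to the composite of `A`.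
  rw [PlusArr.tree_subst, Tree.castE_split _ (congrArg M.std H.f), H.subst]
  congr 2
  funext i
  by_cases hi : i = p
  -- At the node `p` the nodes of `B` appear with their labels `l'`, and `hS` applies; every other
  -- node has kept its label from `A`.
  · subst hi
    rw [dif_pos rfl, ← hS, Tree.castE_castE]
    congr 2
    funext j
    rw [Tree.castE_castE]
    exact Tree.castE_apply _ S (lbl_inr e l l' j) _ _
  · rw [dif_neg hi, Tree.castE_castE]
    exact Tree.castE_apply _ S (lbl_inl e l l' ⟨i, hi⟩) _ _

end PlusArr

/-- The tree of a labelled arrow of `M₊`, its nodes being numbered by the labels. -/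
noncomputable def labTree (α : MLab (plus M τ) x d) :
    Tree M.xi (fun k => M.std (x k)) (M.std d).src (M.std d).tgt :=
  PlusArr.tree α.arr α.lab (fun i => (α.src_eq i).symm) α.tgt_eq

theorem eval_labTree (α : MLab (plus M τ) x d) :
    LArr.Rel (labTree α).eval (LArr.of (M.std d).arr) :=
  PlusArr.eval_tree _ _ _ _

/-- The chosen numbering is unique, so a tree determines its arrow of `M₊`, and bijective labels
then determine which position carries which label. -/
theorem labTree_injective {α β : MLab (plus M τ) x d} (hα : Function.Bijective α.lab)
    (hβ : Function.Injective β.lab) (h : labTree α = labTree β) : α = β := by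
  obtain ⟨h1, h2⟩ := PlusArr.unique (A := α.arr) (B := β.arr) x α.lab β.lab
    (fun i => (α.src_eq i).symm) (fun i => (β.src_eq i).symm) hα.1 hβ
    (Eq.trans (b := d) α.tgt_eq β.tgt_eq.symm) (Tree.castE_shift _ _ h)
  refine MLab.ext' h1 fun i j hij => ?_
  -- `h2` only says that equal labels sit at equal positions. Surjectivity of `α.lab` supplies a
  -- position of `α` with the label of `j`, and this position must be `i`.
  obtain ⟨i', hi'⟩ := hα.2 (β.lab j)
  rw [← hi', Fin.ext (hij.trans (h2 i' j hi').symm)]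

theorem labTree_map (θ : K → L) (hθ : ∀ k, y (θ k) = x k) (α : MLab (plus M τ) x d) :
    labTree (α.map (y := y) θ hθ) =
      (labTree α).relabel (G := fun k => M.std (y k)) θ fun k => congrArg M.std (hθ k) :=
  (PlusArr.tree_relabel (y := y) α.arr α.lab (fun i => (α.src_eq i).symm) α.tgt_eq θ hθ).symm

theorem labTree_pure (k : K) (h : x k = d) :
    labTree (MLab.pure (M := plus M τ) (x := x) k h) =
      Tree.corolla k (M.std d) (congrArg M.std h) := by
  subst h
  exact Tree.relabel_corolla (F := fun _ : Fin 1 => M.std (x k))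
    (G := fun k => M.std (x k)) (fun _ => k) (fun _ => rfl) 0

/-- Composition in `M₊` is substitution at a node, and the labels of `psub` follow the nodes through
it, so this is `IsComp.tree_subst` for labelled arrows. -/
theorem labTree_psub_subst (α : MLab (plus M τ) x d) (k : K) (p : Fin ((plus M τ).arity α.arr))
    (hk : α.lab p = k) (β : MLab (plus M τ) x (x k)) (h : x k = (plus M τ).src α.arr p)
    {J : Type} {G : J → Elt M.xi} (S : ∀ k, Tree M.xi G (M.std (x k)).src (M.std (x k)).tgt)
    (hS : (labTree β).subst S = S k) :
    (labTree (α.psub p β h)).subst S = (labTree α).subst S := by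
  subst hk
  exact (PlusArr.isComp_comp α.arr β.arr p (β.tgt_eq.trans h)).tree_subst α.lab
    (fun i => (α.src_eq i).symm) α.tgt_eq β.lab (fun i => (β.src_eq i).symm) _ _ S hS

theorem labTree_map_subst (θ : K → L) (hθ : ∀ k, y (θ k) = x k) (α : MLab (plus M τ) x d)
    {J : Type} {G : J → Elt M.xi} (S : ∀ k, Tree M.xi G (M.std (y k)).src (M.std (y k)).tgt) :
    (labTree (α.map (y := y) θ hθ)).subst S =
      (labTree α).subst fun k => Tree.castE (congrArg M.std (hθ k)) (S (θ k)) :=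
  (congrArg _ (labTree_map θ hθ α)).trans (Tree.subst_relabel' _ _ _ _)

/-- `bind` is known only as the outcome of a sequence of one-input compositions. A substitution is
chosen whose value on the current tree is the same after every step; comparing its values at the two
ends gives the formula. -/
theorem labTree_bind (α : MLab (plus M τ) x d) (s : ∀ k, MLab (plus M τ) y (x k)) :
    labTree (α.bind s) = (labTree α).subst fun k => labTree (s k) := by
  -- A label in `K` is still to be composed with, so `S` inserts the tree it stands for; a label in
  -- `L` is final, so `S` inserts a corolla and leaves the node as it is.
  let S : ∀ i, Tree M.xi (fun l => M.std (y l)) (M.std (Sum.elim x y i)).src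
      (M.std (Sum.elim x y i)).tgt
    | .inl k => labTree (s k)
    | .inr l => Tree.corolla l (M.std (y l)) rfl
  -- On arrows with final labels only, `S` changes nothing. This applies both to the result and to
  -- each `s k`.
  have hinr : ∀ {c : M.Arr} (γ : MLab (plus M τ) y c),
      (labTree (γ.map (y := Sum.elim x y) Sum.inr fun _ => rfl)).subst S = labTree γ := by
    intro c γ
    refine (labTree_map_subst (y := Sum.elim x y) _ _ _ _).trans ?_
    refine (Tree.subst_eq_relabel (fun l => l) (fun _ => rfl) _).trans ?_
    exact Tree.relabel_id _ _ (fun _ => rfl) _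
  have hsteps : ∀ {β γ : MLab (plus M τ) (Sum.elim x y) d}, MLab.Steps (MLab.Rule s) β γ →
      (labTree (x := Sum.elim x y) γ).subst S = (labTree (x := Sum.elim x y) β).subst S := by
    intro β γ h
    induction h with
    | refl => rfl
    | tail _ hs ih =>
      rw [← ih]
      obtain ⟨p, (k | l), hi, δ, hδ, rfl⟩ := hs
      -- A step inserts `s k` at a node labelled `k`, where `S` would have inserted the tree of `s
      -- k` anyway.
      · refine labTree_psub_subst (x := Sum.elim x y) _ _ p hi δ _ S ?_
        obtain rfl : δ = _ := hδ
        exact hinr (s k)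
      · exact hδ.elim
  exact (hinr (α.bind s)).symm.trans ((hsteps (MLab.isBind_bind α s)).trans
    (labTree_map_subst (y := Sum.elim x y) _ _ _ _))

end

/-! ### Arrows of `ξ(M₊)` as configurations -/

theorem nodes_labTree_of_bijective {n : ℕ} {x : Fin n → M.Arr} {d : M.Arr}
    {α : MLab (plus M τ) x d} (hα : Function.Bijective α.lab) :
    (labTree α).nodes = Finset.univ.val :=
  (PlusArr.nodes_tree _ _ _ _).trans (congrArg Finset.val (Finset.map_univ_equiv (Equiv.ofBijective _ hα)))

/-- Renumber the tree in the chosen order and record the renumbering as the labelling. -/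
theorem exists_labTree_eq {n : ℕ} {x : Fin n → M.Arr} {d : M.Arr} (T : M.Config x d) :
    ∃ α : MLab (plus M τ) x d, Function.Bijective α.lab ∧ labTree α = T.1 := by
  obtain ⟨e, he, -⟩ := τ.existsUnique T
  -- The action of `e` renumbers the nodes by `e⁻¹`, so labelling by `e` restores the original
  -- numbers.
  refine ⟨⟨⟨n, fun i => x (e i), d, T.act e fun _ => rfl, he⟩, e, rfl, fun _ => rfl⟩,
    e.bijective, ?_⟩
  refine (Tree.relabel_relabel _ _ _ _ _).trans ?_
  exact Tree.relabel_id _ _ (fun i => e.apply_symm_apply i) _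

variable (τ) in
/-- The configurations for composing arrows of `M` are the arrows of `ξ(M₊)`. -/
noncomputable def configEquiv {n : ℕ} (x : Fin n → (plus M τ).xi.Obj) (d : (plus M τ).xi.Obj) :
    M.Config (fun i => Discrete.as (x i)) (Discrete.as d) ≃ (plus M τ).xi.Arr x d :=
  Equiv.symm <| Equiv.ofBijective
    (fun α : XiArr (plus M τ) x d => (⟨labTree α.1, nodes_labTree_of_bijective α.2,
      eval_labTree α.1⟩ : M.Config (fun i => Discrete.as (x i)) (Discrete.as d)))
    ⟨fun α β h => Subtype.ext (labTree_injective α.2 β.2.1 (congrArg Subtype.val h)),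
      fun T => by
        obtain ⟨α, hα, h⟩ := exists_labTree_eq (τ := τ) T
        exact ⟨⟨α, hα⟩, Subtype.ext h⟩⟩

theorem labTree_configEquiv {n : ℕ} {x : Fin n → (plus M τ).xi.Obj} {d : (plus M τ).xi.Obj}
    (T : M.Config (fun i => Discrete.as (x i)) (Discrete.as d)) :
    labTree (Subtype.val (configEquiv τ x d T)) = T.1 :=
  congrArg Subtype.val ((configEquiv τ x d).symm_apply_apply T)

/-- Reduces equations in `ξ(M₊)` to equations of trees, in which neither `τ` nor the order of the
steps in a composite is visible. -/
theorem xiArr_ext {n : ℕ} {x : Fin n → (plus M τ).xi.Obj} {d : (plus M τ).xi.Obj}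
    {α β : (plus M τ).xi.Arr x d}
    (h : labTree (Subtype.val α) = labTree (Subtype.val β)) : α = β :=
  Subtype.ext (labTree_injective (Subtype.property α) (Subtype.property β).1 h)

/-! ### The equivalence -/

variable (τ) in
/-- The arrow of `ξ(M₊)` given by a tree of arrows of `ξ(M)`: the permutations of the node labels
are moved into the tree. -/
noncomputable def sliceEquiv {n : ℕ} (F : Fin n → Elt M.xi) (f : Elt M.xi) :
    SliceArr M.xi F f ≃
      (plus M τ).xi.Arr (fun i => (underFunctor τ).obj (F i)) ((underFunctor τ).obj f) :=
  (SliceArr.conjEquiv (fun i => stdIso (F i)) (stdIso f)).trans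
    (configEquiv τ (fun i => (underFunctor τ).obj (F i)) ((underFunctor τ).obj f))

theorem labTree_sliceEquiv {n : ℕ} {F : Fin n → Elt M.xi} {f : Elt M.xi} (T : SliceArr M.xi F f) :
    labTree (Subtype.val (sliceEquiv τ F f T)) =
      Tree.push (stdIso f).inv (T.1.pull fun i => (stdIso (F i)).hom) :=
  labTree_configEquiv _

/-- The one-node tree of `α` becomes a corolla pushed along `stdIso g`, `α` and the inverse of
`stdIso g'`. This composite joins two equal standard elements, so it is an `eqToHom` by uniqueness
of morphisms, and the result is the corolla of an identity of `M₊`. -/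
theorem sliceEquiv_ι {g g' : Elt M.xi} (α : g ⟶ g') :
    sliceEquiv τ (fun _ : Fin 1 => g) g' (SliceArr.ofHom α) =
      (plus M τ).xi.ι ((underFunctor τ).map α) := by
  apply xiArr_ext
  rw [labTree_sliceEquiv]
  refine Eq.trans ?_ (labTree_pure (τ := τ) (x := fun _ : Fin 1 => under g) 0 (under_eq α)).symm
  have h1 : (SliceArr.ofHom α).1 = Tree.push α (Tree.corolla (F := fun _ : Fin 1 => g) 0 g rfl) :=
    (Tree.push_corolla (F := fun _ : Fin 1 => g) 0 α).symm
  rw [h1, Tree.pull_push, Tree.pull, Tree.subst_corolla (F := fun _ : Fin 1 => g), Tree.push_push,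
    Tree.push_push, Subsingleton.elim (_ ≫ _) (eqToHom (congrArg M.std (under_eq α))),
    Tree.push_eqToHom, Tree.castE_corolla]

theorem sliceEquiv_act {n m : ℕ} {F : Fin m → Elt M.xi} {F' : Fin n → Elt M.xi} {f : Elt M.xi}
    (σ : Fin n ≃ Fin m) (h : ∀ i, F' i = F (σ i)) (T : SliceArr M.xi F f) :
    sliceEquiv τ F' f (T.act σ h) = (plus M τ).xi.act σ
      (fun i => congrArg (underFunctor τ).obj (h i)) (sliceEquiv τ F f T) := by
  apply xiArr_ext
  have hσ : ∀ i, F' (σ.symm i) = F i := fun i => by rw [h, Equiv.apply_symm_apply]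
  -- The action of `σ` in `ξ(M₊)` changes labels by `σ⁻¹`, and hence renumbers the nodes of the tree
  -- by `σ⁻¹`, as the action in the slice does.
  have h1 := labTree_map (x := fun i => under (F i)) (y := fun i => under (F' i)) σ.symm
    (fun i => congrArg under (hσ i)) (Subtype.val (sliceEquiv τ F f T))
  have h2 := congrArg (Tree.relabel (G := fun i => M.std (under (F' i))) σ.symm
    (fun i => congrArg (fun g => M.std (under g)) (hσ i))) (labTree_sliceEquiv (τ := τ) T)
  refine (labTree_sliceEquiv _).trans (Eq.trans ?_ (h1.trans h2).symm)
  exact SliceArr.push_pull_act (X := fun g => M.std (under g)) stdIso σ h _ T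

/-- By `labTree_bind` composition in `ξ(M₊)` is substitution of trees, as it is in the slice; the
isomorphisms `stdIso` introduced in between cancel by `push_pull_comp`. -/
theorem sliceEquiv_comp {k : ℕ} {F : Fin k → Elt M.xi} {f : Elt M.xi} {m : Fin k → ℕ}
    {z : ∀ i, Fin (m i) → Elt M.xi} (T : SliceArr M.xi F f) (S : ∀ i, SliceArr M.xi (z i) (F i)) :
    sliceEquiv τ _ f (T.comp S) = (plus M τ).xi.comp (sliceEquiv τ F f T)
      (fun i => sliceEquiv τ (z i) (F i) (S i)) := by
  apply xiArr_ext
  let w : Fin (∑ i, m i) → Elt M.xi := fun p => z (split p).1 (split p).2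
  have hw : ∀ i j, w (split.symm ⟨i, j⟩) = z i j := src_split z
  -- Before composing, `ξ(M₊)` relabels the nodes of the `i`-th argument by their positions in the
  -- concatenated list.
  have h1 := fun i => (labTree_map (x := fun j => under (z i j)) (y := fun p => under (w p))
    (fun j => split.symm ⟨i, j⟩) (fun j => congrArg under (hw i j))
    (Subtype.val (sliceEquiv τ (z i) (F i) (S i)))).trans
      (congrArg (Tree.relabel (G := fun p => M.std (under (w p))) (fun j => split.symm ⟨i, j⟩)
        fun j => congrArg (fun g => M.std (under g)) (hw i j)) (labTree_sliceEquiv (τ := τ) (S i)))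
  have h2 := (labTree_bind (x := fun i => under (F i)) (y := fun p => under (w p))
    (Subtype.val (sliceEquiv τ F f T)) _).trans
      (congrArg₂ (fun U S => Tree.subst S U) (labTree_sliceEquiv (τ := τ) T) (funext h1))
  refine (labTree_sliceEquiv _).trans (Eq.trans ?_ h2.symm)
  exact SliceArr.push_pull_comp (X := fun g => M.std (under g)) stdIso T S _

variable (τ) in
/-- The equivalence `ξ(M)⁺ ≃ ξ(M₊)`. -/
noncomputable def sliceHom : SymMulticat.Hom (SymMulticat.slice M.xi) (plus M τ).xi where
  F₀ := underFunctor τ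
  map {_ F f} T := sliceEquiv τ F f T
  map_ι α := sliceEquiv_ι α
  map_comp T S := sliceEquiv_comp T S
  map_act σ h T := sliceEquiv_act σ h T

end GenMulticat

theorem mainTheorem6 (M : GenMulticat.{u, w}) (τ : GenMulticat.NodeOrder M) :
    SymMulticat.Equivalent (SymMulticat.slice (GenMulticat.xi M))
      (GenMulticat.xi (GenMulticat.plus M τ)) :=
  ⟨GenMulticat.sliceHom τ, GenMulticat.isEquivalence_underFunctor τ,
    fun F f => (GenMulticat.sliceEquiv τ F f).bijective⟩
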